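/- Notation. $\mathbb{R}_+=(0,\infty)$, $\mathbb{N}=\{0,1,2,\ldots\}$; functions are $g\colon\mathbb{R}_+\to\mathbb{R}$; $\Delta g(x)=g(x+1)-g(x)$; $\binom{x}{j}=x(x-1)\cdots(x-j+1)/j!$. $\mathcal{C}^r$ is the set of $r$ times continuously differentiable functions on $\mathbb{R}_+$. For $p\in\mathbb{N}$, $\mathcal{K}^p$ is the set of functions that on some neighbourhood of infinity are $p$-convex (all divided differences $g[x_0,\ldots,x_{p+1}]$ with $x_0<\cdots<x_{p+1}$ are $\ge 0$) or $p$-concave (all are $\le 0$). $\mathcal{D}^p\cap\mathcal{K}^p$ is the set of $g\in\mathcal{K}^p$ with $\Delta^pg(n)\to 0$ as $n\to\infty$, $n\in\mathbb{N}$. The asymptotic degree is $\deg g=-1+\min\{q\in\mathbb{N}:\Delta^qg(x)\to0\text{ as }x\to\infty,\ x\in\mathbb{R}\}$ ($\infty$ if there is no such $q$). For $g\in\mathcal{D}^p\cap\mathcal{K}^p$ put $$\Sigma g(x)=\lim_{n\to\infty}\Big(-g(x)+\sum_{k=1}^{n-1}(g(k)-g(x+k))+\sum_{j=1}^p\tbinom{x}{j}\Delta^{j-1}g(n)\Big),\qquad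 x>0,$$ which does not depend on the choice of $p$. If moreover $g$ is continuous, put $\sigma[g]=\int_0^1\Sigma g(t+1)\,dt$ and, with $q=1+\deg g$, $$\gamma[g]=-\lim_{n\to\infty}\int_0^1\sum_{k=1}^{n-1}\Big(g(t+k)-\sum_{j=0}^{q}\tbinom{t}{j}\Delta^jg(k)\Big)dt .$$ A series $\sum_{k\ge1}u_k$ with sum $S$ on $[0,\infty)$ *can be repeatedly integrated term by term* if the $u_k$ and $S$ are continuous on $[0,\infty)$ and, for every finite list $a_1,\ldots,a_m\ge0$, applying the successive operators $f\mapsto\int_{a_i}^{x}f(t)\,dt$ to the terms gives a series that converges to the result of applying them to $S$, uniformly on bounded subsets of $[0,\infty)$. It *can be differentiated term by term up to $r$ times* if the $u_k$ and $S$ are of class $\mathcal{C}^r$ on $\mathbb{R}_+$ and, for $0\le j\le r$, $\sum_{k\ge1} u_k^{(j)}$ converges to $S^{(j)}$ uniformly on bounded subsets of $\mathbb{R}_+$. **Theorem.** Let $g\colon\mathbb{R}_+\to\mathbb{R}$. **(I) Eulerian form.** Let $g\in\mathcal{D}^p\cap\mathcal{K}^p$ for some $p\in\mathbb{N}$. (a)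 For any $x>0$, $$\Sigma g(x)=-g(x)+\sum_{j=1}^p\tbinom{x}{j}\Delta^{j-1}g(1)-\sum_{k=1}^\infty\Big(g(x+k)-\sum_{j=0}^p\tbinom{x}{j}\Delta^jg(k)\Big)$$ and the series converges uniformly on any bounded subset of $[0,\infty)$. (b) If $g\in\mathcal{C}^0$, then $\Sigma g\in\mathcal{C}^0$ and the series can be repeatedly integrated term by term. (c) If $g\in\mathcal{C}^r\cap\mathcal{K}^{\max\{p,r\}}$ for some $r\in\mathbb{N}$, then $\Sigma g\in\mathcal{C}^r$ and the series can be differentiated term by term up to $r$ times. **(II) Weierstrassian form, $\deg g=-1$.** Let $g\in\mathcal{C}^0\cap\mathcal{D}^0\cap\mathcal{K}^0$. (a) The limit defining $\gamma[g]$ exists and $\gamma[g]=\sigma[g]$. (b) For any $x>0$, $$\Sigma g(x)=\sigma[g]-g(x)-\sum_{k=1}^\infty\Big(g(x+k)-\int_k^{k+1}g(t)\,dt\Big)$$ and the series converges uniformly on any bounded subset of $[0,\infty)$. (c) $\Sigma g\in\mathcal{C}^0$ and the series can be repeatedly integrated term by term. (d) If $g\in\mathcal{C}^r\cap\mathcal{K}^r$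 for some $r\in\mathbb{N}$, then $\Sigma g\in\mathcal{C}^r$ and the series can be differentiated term by term up to $r$ times. **(III) Weierstrassian form, $\deg g\ge0$.** Let $g\in\mathcal{C}^p\cap\mathcal{D}^p\cap\mathcal{K}^p$ with $\deg g=p-1$ for some integer $p\ge1$. (a) The limit defining $\gamma[g^{(p)}]$ exists and $\gamma[g^{(p)}]=\sigma[g^{(p)}]=g^{(p-1)}(1)-(\Sigma g)^{(p)}(1)$. (b) For any $x>0$, $$\Sigma g(x)=\sum_{j=1}^{p-1}\tbinom{x}{j}\Delta^{j-1}g(1)+\tbinom{x}{p}(\Sigma g)^{(p)}(1)-g(x)-\sum_{k=1}^\infty\Big(g(x+k)-\sum_{j=0}^{p-1}\tbinom{x}{j}\Delta^jg(k)-\tbinom{x}{p}g^{(p)}(k)\Big)$$ and the series converges uniformly on any bounded subset of $[0,\infty)$. (c) $\Sigma g\in\mathcal{C}^p$ and the series can be repeatedly integrated term by term. (d) If $g\in\mathcal{C}^{\max\{p,r\}}\cap\mathcal{K}^{\max\{p,r\}}$ for some $r\in\mathbb{N}$, then $\Sigma g\in\mathcal{C}^{\max\{p,r\}}$ and the series can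 be differentiated term by term up to $\max\{p,r\}$ times. -/

import Mathlib

open Set Filter Topology MeasureTheory

noncomputable section

namespace PrincipalSum

/-! Functions `ℝ₊ → ℝ`, with `ℝ₊ = (0, ∞)`, are represented by functions `ℝ → ℝ` of which only the
values on `Set.Ioi 0` matter.  `(fwdDiff (1 : ℝ))^[j] g` is the `j`-th forward difference with step `1`, and
`Ring.choose x j` is the binomial coefficient `x (x-1) ⋯ (x-j+1) / j!`. -/

/-- The divided difference `f[x₀, …, xₙ]` at pairwise distinct points. -/
def dividedDiff {n : ℕ} (f : ℝ → ℝ) (x : Fin (n + 1) → ℝ) : ℝ :=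
  ∑ k, f (x k) / ∏ j ∈ Finset.univ.erase k, (x k - x j)

/-- `f` is `p`-convex on `I`: the divided differences at `p + 2` increasing points are `≥ 0`. -/
def ConvexOfOrderOn (p : ℕ) (f : ℝ → ℝ) (I : Set ℝ) : Prop :=
  ∀ x : Fin (p + 1 + 1) → ℝ, StrictMono x → (∀ i, x i ∈ I) → 0 ≤ dividedDiff f x

/-- `f` is `p`-concave on `I`. -/
def ConcaveOfOrderOn (p : ℕ) (f : ℝ → ℝ) (I : Set ℝ) : Prop :=
  ∀ x : Fin (p + 1 + 1) → ℝ, StrictMono x → (∀ i, x i ∈ I) → dividedDiff f x ≤ 0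

/-- The class `𝒦^p`: eventually `p`-convex or eventually `p`-concave. -/
def InK (p : ℕ) (f : ℝ → ℝ) : Prop :=
  (∃ a : ℝ, 0 < a ∧ ConvexOfOrderOn p f (Ioi a)) ∨
    (∃ a : ℝ, 0 < a ∧ ConcaveOfOrderOn p f (Ioi a))

/-- The class `𝒟^p_ℕ`: `Δ^p f(n) → 0` along the integers. -/
def InDNat (p : ℕ) (f : ℝ → ℝ) : Prop :=
  Tendsto (fun n : ℕ => ((fwdDiff (1 : ℝ))^[p] f) (n : ℝ)) atTop (𝓝 0)

/-- The class `𝒟^p_ℝ`: `Δ^p f(x) → 0` as `x → ∞`. -/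
def InDReal (p : ℕ) (f : ℝ → ℝ) : Prop :=
  Tendsto ((fwdDiff (1 : ℝ))^[p] f) atTop (𝓝 0)

/-- The class `𝒟^p ∩ 𝒦^p`. -/
def InDK (p : ℕ) (f : ℝ → ℝ) : Prop := InDNat p f ∧ InK p f

/-- The class `𝒞^r` of functions on `(0, ∞)`. -/
def InC (r : ℕ) (f : ℝ → ℝ) : Prop := ContDiffOn ℝ r f (Ioi 0)

/-- `min {q : f ∈ 𝒟^q_ℝ}`, i.e. `1 + deg f` (meaningful when `deg f` is finite). -/
def succDeg (f : ℝ → ℝ) : ℕ := sInf {q : ℕ | InDReal q f}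

open Classical in
/-- The asymptotic degree `deg f = -1 + min {q : f ∈ 𝒟^q_ℝ}`, which is `∞` if there is no such `q`. -/
def asympDeg (f : ℝ → ℝ) : WithTop ℤ :=
  if ∃ q : ℕ, InDReal q f then (((succDeg f : ℤ) - 1 : ℤ) : WithTop ℤ) else ⊤

/-- `f^p_n[g](x) = -g(x) + ∑_{k=1}^{n-1} (g(k) - g(x+k)) + ∑_{j=1}^p C(x,j) Δ^{j-1} g(n)`. -/
def gaussSeq (p n : ℕ) (g : ℝ → ℝ) (x : ℝ) : ℝ :=
  -g x + ∑ k ∈ Finset.Ico 1 n, (g k - g (x + k)) +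
    ∑ j ∈ Finset.Icc 1 p, Ring.choose x j * ((fwdDiff (1 : ℝ))^[j - 1] g) (n : ℝ)

open Classical in
/-- The map `Σ` on `dom Σ = ⋃_p 𝒟^p ∩ 𝒦^p`: the pointwise limit of `f^p_n[g]` as `n → ∞`, for a `p`
such that `g ∈ 𝒟^p ∩ 𝒦^p` (the least one is used here; the value `0` off the domain is junk). -/
def Sig (g : ℝ → ℝ) (x : ℝ) : ℝ :=
  if h : ∃ p : ℕ, InDK p g then limUnder atTop (fun n : ℕ => gaussSeq (Nat.find h) n g x) else 0

/-- The asymptotic constant `σ[g] = ∫_0^1 Σg(t+1) dt`. -/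
def asympConst (g : ℝ → ℝ) : ℝ := ∫ t in (0 : ℝ)..1, Sig g (t + 1)

/-- `ρ^p_a[g](x) = g(x+a) - ∑_{j=0}^{p-1} C(x,j) Δ^j g(a)`. -/
def rho (p : ℕ) (a : ℝ) (g : ℝ → ℝ) (x : ℝ) : ℝ :=
  g (x + a) - ∑ j ∈ Finset.range p, Ring.choose x j * ((fwdDiff (1 : ℝ))^[j] g) a

/-- The remainder in Gregory's formula: `R^q_{m,n}[g] = ∫_0^1 ∑_{k=m}^{n-1} ρ^{q+1}_k[g](t) dt`. -/
def gregoryRem (q m n : ℕ) (g : ℝ → ℝ) : ℝ :=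
  ∫ t in (0 : ℝ)..1, ∑ k ∈ Finset.Ico m n, rho (q + 1) k g t

/-- The generalized Euler constant `γ[g] = -R^p_{1,∞}[g] = -lim_n R^p_{1,n}[g]`, `p = 1 + deg g`. -/
def eulerConst (g : ℝ → ℝ) : ℝ :=
  limUnder atTop (fun n : ℕ => -gregoryRem (succDeg g) 1 n g)

/-- The limit that defines `γ[g]` exists (so that `eulerConst g` is its value). -/
def HasEulerConst (g : ℝ → ℝ) : Prop :=
  Tendsto (fun n : ℕ => -gregoryRem (succDeg g) 1 n g) atTop (𝓝 (eulerConst g))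

/-- The series `∑_{k ≥ 1} u k` converges to `S`, uniformly on every bounded subset of `A`. -/
def SumsUniformlyOnBounded (A : Set ℝ) (u : ℕ → ℝ → ℝ) (S : ℝ → ℝ) : Prop :=
  ∀ E : Set ℝ, E ⊆ A → Bornology.IsBounded E →
    TendstoUniformlyOn (fun (n : ℕ) (x : ℝ) => ∑ k ∈ Finset.Icc 1 n, u k x) S atTop E

/-- Repeated integration with the given list of base points:
`iterInt [a₁, …, aₘ] f (x) = ∫_{a₁}^x ∫_{a₂}^{t₁} ⋯ ∫_{aₘ}^{tₘ₋₁} f(tₘ) dtₘ ⋯ dt₁`. -/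
def iterInt : List ℝ → (ℝ → ℝ) → ℝ → ℝ
  | [], f => f
  | a :: l, f => fun x => ∫ t in a..x, iterInt l f t

/-- The series `∑_{k ≥ 1} u k = S` can be repeatedly integrated term by term on bounded intervals
of `[0, ∞)`: terms and sum are continuous there, and for all base points in `[0, ∞)` the series of
repeated integrals converges to the repeated integral of `S`, uniformly on bounded subsets. -/
def IntegrableTermwise (u : ℕ → ℝ → ℝ) (S : ℝ → ℝ) : Prop :=
  (∀ k, 1 ≤ k → ContinuousOn (u k) (Ici 0)) ∧ ContinuousOn S (Ici 0) ∧
    ∀ l : List ℝ, (∀ a ∈ l, 0 ≤ a) →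
      SumsUniformlyOnBounded (Ici 0) (fun k => iterInt l (u k)) (iterInt l S)

/-- The series `∑_{k ≥ 1} u k = S` can be differentiated term by term up to `r` times on `(0, ∞)`:
terms and sum are of class `𝒞^r` there, and for `j ≤ r` the series of `j`-th derivatives converges
to the `j`-th derivative of `S`, uniformly on bounded subsets of `(0, ∞)`. -/
def DifferentiableTermwise (r : ℕ) (u : ℕ → ℝ → ℝ) (S : ℝ → ℝ) : Prop :=
  (∀ k, 1 ≤ k → InC r (u k)) ∧ InC r S ∧
    ∀ j, j ≤ r →
      SumsUniformlyOnBounded (Ioi 0) (fun k => iteratedDeriv j (u k)) (iteratedDeriv j S)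

/-- The `k`-th term of the Eulerian series: `g(x+k) - ∑_{j=0}^p C(x,j) Δ^j g(k)`. -/
def eulerTerm (p : ℕ) (g : ℝ → ℝ) (k : ℕ) (x : ℝ) : ℝ :=
  g (x + k) - ∑ j ∈ Finset.range (p + 1), Ring.choose x j * ((fwdDiff (1 : ℝ))^[j] g) (k : ℝ)

/-- The `k`-th term of the Weierstrassian series for `p = 0`: `g(x+k) - ∫_k^{k+1} g(t) dt`. -/
def weierTermZero (g : ℝ → ℝ) (k : ℕ) (x : ℝ) : ℝ :=
  g (x + k) - ∫ t in (k : ℝ)..(k + 1), g t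

/-- The `k`-th term of the Weierstrassian series for `p ≥ 1`:
`g(x+k) - ∑_{j=0}^{p-1} C(x,j) Δ^j g(k) - C(x,p) g^{(p)}(k)`. -/
def weierTerm (p : ℕ) (g : ℝ → ℝ) (k : ℕ) (x : ℝ) : ℝ :=
  g (x + k) - ∑ j ∈ Finset.range p, Ring.choose x j * ((fwdDiff (1 : ℝ))^[j] g) (k : ℝ)
    - Ring.choose x p * iteratedDeriv p g k

end PrincipalSum

end

open PrincipalSum

/-! `eulerTerm p g k x` is the error at `x` of the Newton interpolation of `g (· + k)` at
`0, …, p`, hence `∏ (x - j)` times a difference of two divided differences of order `p` of `g`. If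
`g` is `p`-convex, moving the nodes one at a time compares both of them with `Δ^p g / p!`, so that
on `[0, M]` the error is at most `M ^ p * (Δ^p g (k + M) - Δ^p g k)`. As `Δ^p g` tends to `0`, these
bounds telescope and the Eulerian series converges uniformly.

The class `𝒟^(p+1) ∩ 𝒦^(p+1)` is sent into `𝒟^p ∩ 𝒦^p` by differentiation, and a series of
polynomials of bounded degree that converges pointwise converges together with all its derivatives.
Hence any pointwise convergent series `∑ (g (x + k) - P k x)` with polynomials `P k` of bounded
degree converges uniformly and can be differentiated as often as the class of `g` allows.

The Weierstrassian series differ from the Eulerian one only in the coefficient of `choose x p`.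
Since `Σ` of the `p`-th derivative of `g` and the `p`-th derivative of `Σg` differ by a constant,
these coefficients sum up to a value of the latter, and integrating it gives `σ[g^(p)]`. -/

noncomputable section

namespace PrincipalSum

open scoped fwdDiff Polynomial

section DividedDifference

variable {F : Type*} [Field F] [DecidableEq F]

/-- The divided difference of `f` at the points of a finite set, that is, the leading coefficient
of the polynomial interpolating `f` there. Indexing by finite sets instead of increasing tuples
makes exchanging a single node an operation on `insert`. -/
def divDiff (f : F → F) (s : Finset F) : F :=
  ∑ x ∈ s, f x / ∏ y ∈ s.erase x, (x - y)

lemma divDiff_eq_coeff_interpolate (f : F → F) (s : Finset F) :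
    divDiff f s = (Lagrange.interpolate s id f).coeff (s.card - 1) := by
  have hinj : Set.InjOn id (s : Set F) := Set.injOn_id _
  rw [Lagrange.coeff_eq_sum hinj (Lagrange.degree_interpolate_lt f hinj)]
  exact Finset.sum_congr rfl fun x hx => by rw [Lagrange.eval_interpolate_at_node f hinj hx]; rfl

lemma interpolate_insert (f : F → F) {s : Finset F} {a : F} (ha : a ∉ s) :
    Lagrange.interpolate (insert a s) id f =
      Lagrange.interpolate s id f +
        Polynomial.C (divDiff f (insert a s)) * Lagrange.nodal s id := by
  have hinj (t : Finset F) : Set.InjOn id (t : Set F) := Set.injOn_id _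
  set P := Lagrange.interpolate (insert a s) id f with hP
  have hcoeff : P.coeff s.card = divDiff f (insert a s) := by
    rw [divDiff_eq_coeff_interpolate, Finset.card_insert_of_notMem ha, Nat.add_sub_cancel]
  have hPdeg : P.degree < (s.card + 1 : ℕ) := by
    rw [← Finset.card_insert_of_notMem ha]
    exact Lagrange.degree_interpolate_lt f (hinj _)
  rw [← sub_eq_iff_eq_add, ← hcoeff]
  refine Lagrange.eq_interpolate_of_eval_eq f (hinj s) ?_ fun x hx => ?_
  · rw [Polynomial.degree_lt_iff_coeff_zero]
    intro m hm
    rcases hm.eq_or_lt with rfl | hm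
    · have hmonic := (Lagrange.nodal_monic (s := s) (v := (id : F → F))).coeff_natDegree
      rw [Lagrange.natDegree_nodal] at hmonic
      rw [Polynomial.coeff_sub, Polynomial.coeff_C_mul, hmonic, mul_one, sub_self]
    · rw [Polynomial.coeff_sub, Polynomial.coeff_C_mul,
        Polynomial.degree_lt_iff_coeff_zero _ _ |>.1 hPdeg m hm,
        Polynomial.coeff_eq_zero_of_natDegree_lt (p := Lagrange.nodal s id)
          (by rwa [Lagrange.natDegree_nodal]), mul_zero, sub_zero]
  · have hnode := Lagrange.eval_nodal_at_node (v := (id : F → F)) hx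
    have hval := Lagrange.eval_interpolate_at_node f (hinj _) (Finset.mem_insert_of_mem (b := a) hx)
    simp only [id] at hnode hval ⊢
    rw [Polynomial.eval_sub, Polynomial.eval_mul, hnode, mul_zero, sub_zero, hP]
    exact hval

lemma eval_interpolate_add_prod_mul_divDiff (f : F → F) {s : Finset F} {a : F} (ha : a ∉ s) :
    (Lagrange.interpolate s id f).eval a + (∏ y ∈ s, (a - y)) * divDiff f (insert a s) = f a := by
  have h := Lagrange.eval_interpolate_at_node f (Set.injOn_id _) (Finset.mem_insert_self a s)
  rw [interpolate_insert f ha] at h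
  simpa [Lagrange.eval_nodal, mul_comm] using h

lemma sub_eval_eq_prod_mul_divDiff (f : F → F) {s : Finset F} {a : F} (ha : a ∉ s) {P : F[X]}
    (hdeg : P.degree < s.card) (hP : ∀ x ∈ s, P.eval x = f x) :
    f a - P.eval a = (∏ y ∈ s, (a - y)) * divDiff f (insert a s) := by
  rw [Lagrange.eq_interpolate_of_eval_eq f (Set.injOn_id _) hdeg hP, sub_eq_iff_eq_add',
    eval_interpolate_add_prod_mul_divDiff f ha]

lemma divDiff_insert_sub_divDiff_insert (f : F → F) {t : Finset F} {a b : F} (ha : a ∉ t)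
    (hb : b ∉ t) (hab : a ≠ b) :
    divDiff f (insert a t) - divDiff f (insert b t) =
      (a - b) * divDiff f (insert a (insert b t)) := by
  have hne : ∏ y ∈ t, (a - y) ≠ 0 :=
    Finset.prod_ne_zero_iff.2 fun y hy => sub_ne_zero.2 fun h => ha (h ▸ hy)
  have h₁ := eval_interpolate_add_prod_mul_divDiff f ha
  have h₂ := eval_interpolate_add_prod_mul_divDiff f (s := insert b t) (a := a) (by simp [hab, ha])
  rw [interpolate_insert f hb, Finset.prod_insert hb] at h₂
  simp only [Polynomial.eval_add, Polynomial.eval_mul, Polynomial.eval_C, Lagrange.eval_nodal,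
    id] at h₂
  exact mul_left_cancel₀ hne (by linear_combination h₁ - h₂)

end DividedDifference

lemma dividedDiff_eq_divDiff_image {n : ℕ} (f : ℝ → ℝ) {x : Fin (n + 1) → ℝ}
    (hx : Function.Injective x) : dividedDiff f x = divDiff f (Finset.univ.image x) := by
  rw [divDiff, Finset.sum_image hx.injOn]
  refine Finset.sum_congr rfl fun k _ => ?_
  rw [← Finset.image_erase hx, Finset.prod_image hx.injOn]

lemma convexOfOrderOn_iff {p : ℕ} {f : ℝ → ℝ} {I : Set ℝ} :
    ConvexOfOrderOn p f I ↔ ∀ s : Finset ℝ, s.card = p + 2 → ↑s ⊆ I → 0 ≤ divDiff f s := by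
  constructor
  · intro h s hs hI
    have := h (s.orderEmbOfFin hs) (s.orderEmbOfFin hs).strictMono
      (fun i => hI (Finset.orderEmbOfFin_mem s hs i))
    rwa [dividedDiff_eq_divDiff_image _ (s.orderEmbOfFin hs).injective,
      Finset.image_orderEmbOfFin_univ] at this
  · intro h x hx hI
    rw [dividedDiff_eq_divDiff_image _ hx.injective]
    refine h _ (by simp [Finset.card_image_of_injective _ hx.injective]) ?_
    simpa [Set.subset_def] using hI

lemma concaveOfOrderOn_iff_convexOfOrderOn_neg {p : ℕ} {f : ℝ → ℝ} {I : Set ℝ} :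
    ConcaveOfOrderOn p f I ↔ ConvexOfOrderOn p (-f) I := by
  simp [ConcaveOfOrderOn, ConvexOfOrderOn, dividedDiff, neg_div]

namespace ConvexOfOrderOn

variable {p : ℕ} {f : ℝ → ℝ} {I : Set ℝ}

lemma divDiff_insert_le (hf : ConvexOfOrderOn p f I) {t : Finset ℝ} (ht : t.card = p)
    (htI : ↑t ⊆ I) {a b : ℝ} (ha : a ∉ t) (hb : b ∉ t) (hab : a ≤ b) (haI : a ∈ I) (hbI : b ∈ I) :
    divDiff f (insert a t) ≤ divDiff f (insert b t) := by
  rcases hab.eq_or_lt with rfl | hab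
  · exact le_rfl
  have hbat : b ∉ insert a t := by simp [hab.ne', hb]
  have hnonneg : 0 ≤ divDiff f (insert b (insert a t)) := convexOfOrderOn_iff.1 hf _
    (by rw [Finset.card_insert_of_notMem hbat, Finset.card_insert_of_notMem ha, ht])
    (by simp [Set.insert_subset_iff, haI, hbI, htI])
  rw [← sub_nonneg, divDiff_insert_sub_divDiff_insert f hb ha hab.ne']
  exact mul_nonneg (sub_nonneg.2 hab.le) hnonneg

/-- Moving the largest node first keeps the intermediate nodes distinct. -/
lemma divDiff_image_union_le (hf : ConvexOfOrderOn p f I) {ι : Type*} [LinearOrder ι]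
    {x y : ι → ℝ} (s : Finset ι) (hx : StrictMonoOn x s) (hy : StrictMonoOn y s)
    (hxy : ∀ i ∈ s, x i ≤ y i) (hxI : MapsTo x s I) (hyI : MapsTo y s I) (u : Finset ℝ)
    (hcard : s.card + u.card = p + 1) (huI : ↑u ⊆ I) (hu : ∀ i ∈ s, ∀ z ∈ u, y i < z) :
    divDiff f (s.image x ∪ u) ≤ divDiff f (s.image y ∪ u) := by
  induction s using Finset.induction_on_max generalizing u with
  | empty => simp
  | insert i s his ih =>
    have hi : i ∉ s := fun h => (his i h).false
    have his' : i ∈ (↑(insert i s) : Set ι) := by simp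
    have hs : (s : Set ι) ⊆ ↑(insert i s) := by simp
    have hyu : y i ∉ u := fun h => (hu i (Finset.mem_insert_self i s) _ h).false
    have hxlt : ∀ j ∈ s, x j < x i := fun j hj => hx (hs hj) his' (his j hj)
    have hxyi : x i ≤ y i := hxy i (Finset.mem_insert_self i s)
    rw [Finset.card_insert_of_notMem hi] at hcard
    have hdisj : Disjoint (s.image x) u := by
      simp only [Finset.disjoint_left, Finset.mem_image, forall_exists_index, and_imp]
      rintro _ j hj rfl hju
      exact ((hxy j (hs hj)).trans_lt (hu j (hs hj) _ hju)).false
    have hmove : divDiff f (insert (x i) (s.image x ∪ u)) ≤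
        divDiff f (insert (y i) (s.image x ∪ u)) := by
      refine hf.divDiff_insert_le ?_ ?_ ?_ ?_ hxyi (hxI his') (hyI his')
      · rw [Finset.card_union_of_disjoint hdisj, Finset.card_image_of_injOn (hx.mono hs).injOn]
        lia
      · rw [Finset.coe_union, Finset.coe_image]
        exact Set.union_subset (hxI.mono_left hs).image_subset huI
      · simpa using ⟨fun j hj => (hxlt j hj).ne,
          fun h => (hxyi.trans_lt (hu i (Finset.mem_insert_self i s) _ h)).false⟩
      · simpa [hyu] using fun j hj => ((hxlt j hj).trans_le hxyi).ne
    have hrest := ih (hx.mono hs) (hy.mono hs) (fun j hj => hxy j (hs hj))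
      (hxI.mono_left hs) (hyI.mono_left hs) (insert (y i) u)
      (by rw [Finset.card_insert_of_notMem hyu]; lia)
      (by simpa [Set.insert_subset_iff, huI] using hyI his')
      (fun j hj z hz => by
        rcases Finset.mem_insert.1 hz with rfl | hz
        exacts [hy (hs hj) his' (his j hj), hu j (hs hj) z hz])
    rw [Finset.image_insert, Finset.image_insert, Finset.insert_union, Finset.insert_union]
    simp only [Finset.union_insert] at hrest
    exact hmove.trans hrest

lemma divDiff_le_divDiff_image_add (hf : ConvexOfOrderOn p f I) {s : Finset ℝ}
    (hs : s.card = p + 1) (hsI : ↑s ⊆ I) {h : ℝ} (hh : 0 ≤ h) (hshI : MapsTo (· + h) s I) :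
    divDiff f s ≤ divDiff f (s.image (· + h)) := by
  simpa using hf.divDiff_image_union_le s (strictMono_id.strictMonoOn _)
    ((strictMono_id.add_const h).strictMonoOn _) (fun x _ => le_add_of_nonneg_right hh)
    hsI hshI ∅ (by simpa using hs) (by simp) (by simp)

lemma divDiff_le_divDiff (hf : ConvexOfOrderOn p f I) {s t : Finset ℝ} (hs : s.card = p + 1)
    (ht : t.card = p + 1) (hsI : ↑s ⊆ I) (htI : ↑t ⊆ I) (hst : ∀ x ∈ s, ∀ y ∈ t, x ≤ y) :
    divDiff f s ≤ divDiff f t := by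
  simpa using hf.divDiff_image_union_le Finset.univ
    ((s.orderEmbOfFin hs).strictMono.strictMonoOn _)
    ((t.orderEmbOfFin ht).strictMono.strictMonoOn _)
    (fun i _ => hst _ (s.orderEmbOfFin_mem hs i) _ (t.orderEmbOfFin_mem ht i))
    (fun i _ => hsI (s.orderEmbOfFin_mem hs i)) (fun i _ => htI (t.orderEmbOfFin_mem ht i)) ∅
    (by simp) (by simp) (by simp)

end ConvexOfOrderOn

/-- The `n` points `a, a + 1, …, a + n - 1`, at which Newton's formula interpolates. -/
def unitNodes (a : ℝ) (n : ℕ) : Finset ℝ :=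
  (Finset.range n).image (fun j : ℕ => a + j)

lemma mem_unitNodes {a y : ℝ} {n : ℕ} : y ∈ unitNodes a n ↔ ∃ j < n, a + (j : ℝ) = y := by
  simp [unitNodes]

lemma card_unitNodes (a : ℝ) (n : ℕ) : (unitNodes a n).card = n := by
  rw [unitNodes, Finset.card_image_of_injective _ (fun i j h => by simpa using h),
    Finset.card_range]

lemma mem_Ico_of_mem_unitNodes {a y : ℝ} {n : ℕ} (hy : y ∈ unitNodes a n) :
    y ∈ Ico a (a + n) := by
  obtain ⟨j, hj, rfl⟩ := mem_unitNodes.1 hy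
  simpa using hj

lemma mem_Icc_of_mem_unitNodes_succ {a y : ℝ} {n : ℕ} (hy : y ∈ unitNodes a (n + 1)) :
    y ∈ Icc a (a + n) := by
  obtain ⟨j, hj, rfl⟩ := mem_unitNodes.1 hy
  simpa using Nat.lt_succ_iff.1 hj

lemma unitNodes_subset_Ioi {a b : ℝ} (h : a < b) (n : ℕ) : ↑(unitNodes b n) ⊆ Ioi a :=
  fun _ hy => h.trans_le (mem_Ico_of_mem_unitNodes hy).1

lemma unitNodes_succ (a : ℝ) (n : ℕ) : unitNodes a (n + 1) = insert (a + n) (unitNodes a n) := by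
  rw [unitNodes, Finset.range_add_one, Finset.image_insert, unitNodes]

lemma image_add_unitNodes (a h : ℝ) (n : ℕ) :
    (unitNodes a n).image (· + h) = unitNodes (a + h) n := by
  rw [unitNodes, unitNodes, Finset.image_image]
  exact Finset.image_congr fun j _ => by simp only [Function.comp]; ring

lemma unitNodes_succ' (a : ℝ) (n : ℕ) : unitNodes a (n + 1) = insert a (unitNodes (a + 1) n) := by
  rw [unitNodes, Finset.range_add_one', Finset.image_insert, Finset.map_eq_image,
    Finset.image_image, Nat.cast_zero, add_zero, unitNodes]
  congr 1
  exact Finset.image_congr fun j _ =>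
    show a + ((j + 1 : ℕ) : ℝ) = a + 1 + j by push_cast; ring

lemma prod_unitNodes {a x : ℝ} (n : ℕ) :
    ∏ y ∈ unitNodes a n, (x + a - y) = ∏ j ∈ Finset.range n, (x - j) := by
  rw [unitNodes, Finset.prod_image fun i _ j _ h => by simpa using h]
  exact Finset.prod_congr rfl fun j _ => by ring

lemma fwdDiff_iter_eq_factorial_mul_divDiff (f : ℝ → ℝ) (n : ℕ) (a : ℝ) :
    (Δ_[1])^[n] f a = n.factorial * divDiff f (unitNodes a (n + 1)) := by
  induction n generalizing a with
  | zero => simp [divDiff, unitNodes]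
  | succ n ih =>
    have hleft : a ∉ unitNodes (a + 1) n := fun h => by
      linarith [(mem_Ico_of_mem_unitNodes h).1]
    have hright : a + 1 + n ∉ unitNodes (a + 1) n := fun h =>
      (mem_Ico_of_mem_unitNodes h).2.false
    have hne : a + 1 + n ≠ a := by linarith [n.cast_nonneg (α := ℝ)]
    rw [Function.iterate_succ_apply', fwdDiff, ih, ih, ← mul_sub, unitNodes_succ (a + 1),
      unitNodes_succ' a n, divDiff_insert_sub_divDiff_insert f hright hleft hne,
      unitNodes_succ a (n + 1), unitNodes_succ' a n, Nat.factorial_succ]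
    push_cast
    ring_nf

lemma ConvexOfOrderOn.monotoneOn_fwdDiff_iter {p : ℕ} {f : ℝ → ℝ} {a : ℝ}
    (hf : ConvexOfOrderOn p f (Ioi a)) : MonotoneOn ((Δ_[1])^[p] f) (Ioi a) := by
  intro x hx y _ hxy
  have hshift : unitNodes y (p + 1) = (unitNodes x (p + 1)).image (· + (y - x)) := by
    rw [image_add_unitNodes, add_sub_cancel]
  rw [fwdDiff_iter_eq_factorial_mul_divDiff, fwdDiff_iter_eq_factorial_mul_divDiff, hshift]
  refine mul_le_mul_of_nonneg_left (hf.divDiff_le_divDiff_image_add (card_unitNodes _ _)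
    (unitNodes_subset_Ioi hx _) (sub_nonneg.2 hxy) fun z hz => ?_) (Nat.cast_nonneg _)
  exact (unitNodes_subset_Ioi hx _ hz).trans_le (le_add_of_nonneg_right (sub_nonneg.2 hxy))

/-- The binomial coefficient `C(x, j)` as a polynomial in `x`. -/
def binomPoly (j : ℕ) : ℝ[X] :=
  Polynomial.C (j.factorial : ℝ)⁻¹ * descPochhammer ℝ j

lemma eval_binomPoly (j : ℕ) (x : ℝ) : (binomPoly j).eval x = Ring.choose x j := by
  rw [binomPoly, Polynomial.eval_mul, Polynomial.eval_C, Ring.choose_eq_smul,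
    ← Polynomial.aeval_eq_smeval, ← descPochhammer_map (algebraMap ℤ ℝ),
    Polynomial.eval_map_algebraMap, smul_eq_mul]

lemma natDegree_binomPoly (j : ℕ) : (binomPoly j).natDegree = j := by
  rw [binomPoly, Polynomial.natDegree_C_mul (by positivity), descPochhammer_natDegree]

/-- The Newton series `∑_{j < n} c j * C(x, j)` as a polynomial in `x`. -/
def newtonPoly (c : ℕ → ℝ) (n : ℕ) : ℝ[X] :=
  ∑ j ∈ Finset.range n, Polynomial.C (c j) * binomPoly j

lemma eval_newtonPoly (c : ℕ → ℝ) (n : ℕ) (x : ℝ) :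
    (newtonPoly c n).eval x = ∑ j ∈ Finset.range n, Ring.choose x j * c j := by
  simp [newtonPoly, Polynomial.eval_finsetSum, eval_binomPoly, mul_comm]

lemma degree_newtonPoly_lt (c : ℕ → ℝ) (n : ℕ) : (newtonPoly c n).degree < n := by
  rw [← Polynomial.mem_degreeLT]
  refine Submodule.sum_mem _ fun j hj => Polynomial.mem_degreeLT.2 ?_
  refine Polynomial.degree_le_natDegree.trans_lt (Nat.cast_lt.2 ?_)
  exact (Polynomial.natDegree_C_mul_le _ _).trans_lt
    ((natDegree_binomPoly j).trans_lt (Finset.mem_range.1 hj))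

lemma natDegree_newtonPoly_succ_le (c : ℕ → ℝ) (n : ℕ) : (newtonPoly c (n + 1)).natDegree ≤ n :=
  Polynomial.natDegree_sum_le_of_forall_le _ _ fun j hj =>
    (Polynomial.natDegree_C_mul_le _ _).trans
      ((natDegree_binomPoly j).trans_le (Nat.lt_succ_iff.1 (Finset.mem_range.1 hj)))

lemma coeff_newtonPoly_succ (c : ℕ → ℝ) (n : ℕ) :
    (newtonPoly c (n + 1)).coeff n = c n / n.factorial := by
  have hlead : (descPochhammer ℝ n).coeff n = 1 := by
    simpa [descPochhammer_natDegree] using (monic_descPochhammer ℝ n).coeff_natDegree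
  rw [newtonPoly, Finset.sum_range_succ, ← newtonPoly, Polynomial.coeff_add,
    Polynomial.coeff_eq_zero_of_degree_lt (degree_newtonPoly_lt c n), binomPoly,
    Polynomial.coeff_C_mul, Polynomial.coeff_C_mul, hlead]
  ring

lemma iterate_derivative_newtonPoly_succ (c : ℕ → ℝ) (n : ℕ) :
    Polynomial.derivative^[n] (newtonPoly c (n + 1)) = Polynomial.C (c n) := by
  have hconst : (Polynomial.derivative^[n] (newtonPoly c (n + 1))).natDegree = 0 :=
    Nat.le_zero.1 ((Polynomial.natDegree_iterate_derivative _ _).trans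
      (Nat.sub_eq_zero_of_le (natDegree_newtonPoly_succ_le c n)).le)
  rw [Polynomial.eq_C_of_natDegree_eq_zero hconst, Polynomial.coeff_iterate_derivative, zero_add,
    coeff_newtonPoly_succ, Nat.descFactorial_self, nsmul_eq_mul,
    mul_div_cancel₀ _ (by positivity)]

lemma rho_eq_sub_eval_newtonPoly (p : ℕ) (a : ℝ) (g : ℝ → ℝ) (x : ℝ) :
    rho p a g x = g (x + a) - (newtonPoly (fun j => (Δ_[1])^[j] g a) p).eval x := by
  rw [rho, eval_newtonPoly]

lemma rho_natCast_eq_zero {p i : ℕ} (hi : i < p) (a : ℝ) (g : ℝ → ℝ) : rho p a g i = 0 := by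
  have hshift := shift_eq_sum_fwdDiff_iter (1 : ℝ) g i a
  rw [nsmul_eq_mul, mul_one] at hshift
  simp only [nsmul_eq_mul] at hshift
  rw [rho, add_comm, hshift, sub_eq_zero]
  simp only [Ring.choose_natCast]
  refine Finset.sum_subset (Finset.range_mono hi) fun j _ hj => ?_
  rw [Nat.choose_eq_zero_of_lt (by simpa using hj), Nat.cast_zero, zero_mul]

lemma rho_eq_prod_mul_divDiff {p : ℕ} {a x : ℝ} (hx : x + a ∉ unitNodes a p) (g : ℝ → ℝ) :
    rho p a g x =
      (∏ j ∈ Finset.range p, (x - j)) * divDiff g (insert (x + a) (unitNodes a p)) := by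
  set P := Polynomial.taylor (-a) (newtonPoly (fun j => (Δ_[1])^[j] g a) p) with hP
  have heval (y : ℝ) : g (y + a) - P.eval (y + a) = rho p a g y := by
    rw [rho_eq_sub_eval_newtonPoly, hP, Polynomial.taylor_eval, add_neg_cancel_right]
  rw [← heval x, ← prod_unitNodes]
  refine sub_eval_eq_prod_mul_divDiff g hx ?_ fun y hy => ?_
  · rw [hP, Polynomial.degree_taylor, card_unitNodes]
    exact degree_newtonPoly_lt _ p
  · obtain ⟨j, hj, rfl⟩ := mem_unitNodes.1 hy
    have := heval j
    rw [rho_natCast_eq_zero hj, add_comm] at this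
    linarith

/-- In `rho (p + 1) a g x`, the node `a` is exchanged against `x + a`: the factor `x` of Newton's
error formula turns the divided difference of order `p + 1` into a difference of order `p`. -/
lemma rho_succ_eq_prod_mul_sub {p : ℕ} {a x : ℝ} (hx : x + a ∉ unitNodes a (p + 1)) (g : ℝ → ℝ) :
    rho (p + 1) a g x = (∏ j ∈ Finset.range p, (x - (j + 1 : ℕ))) *
      (divDiff g (insert (x + a) (unitNodes (a + 1) p)) -
        divDiff g (unitNodes a (p + 1))) := by
  have ha : a ∉ unitNodes (a + 1) p := fun h => by linarith [(mem_Ico_of_mem_unitNodes h).1]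
  rw [rho_eq_prod_mul_divDiff hx, Finset.prod_range_succ', unitNodes_succ']
  rw [unitNodes_succ', Finset.mem_insert, not_or] at hx
  rw [divDiff_insert_sub_divDiff_insert g hx.2 ha hx.1, Nat.cast_zero]
  ring

lemma ConvexOfOrderOn.divDiff_insert_unitNodes_mem_Icc {p : ℕ} {g : ℝ → ℝ} {a : ℝ}
    (hg : ConvexOfOrderOn p g (Ioi a)) {k M x : ℝ} (hk : a < k) (hpM : p ≤ M)
    (hx : x ∈ Icc 0 M) (hxk : x + k ∉ unitNodes (k + 1) p) :
    divDiff g (insert (x + k) (unitNodes (k + 1) p)) ∈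
      Icc (divDiff g (unitNodes k (p + 1))) (divDiff g (unitNodes (k + M) (p + 1))) := by
  obtain ⟨hx₀, hxM⟩ := hx
  have htI : ↑(unitNodes (k + 1) p) ⊆ Ioi a := unitNodes_subset_Ioi (by linarith) p
  have hxI : a < x + k := by linarith
  constructor
  · have hkt : k ∉ unitNodes (k + 1) p := fun h => by linarith [(mem_Ico_of_mem_unitNodes h).1]
    rw [unitNodes_succ']
    exact hg.divDiff_insert_le (card_unitNodes _ _) htI hkt hxk (by linarith) hk hxI
  · refine hg.divDiff_le_divDiff (by rw [Finset.card_insert_of_notMem hxk, card_unitNodes])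
      (card_unitNodes _ _) (by simp [Set.insert_subset_iff, htI, hxI])
      (unitNodes_subset_Ioi (by linarith) _) fun y hy z hz => ?_
    have hyM : y ≤ k + M := by
      rcases Finset.mem_insert.1 hy with rfl | hy
      · linarith
      · have hy' := Finset.mem_insert_of_mem (b := k) hy
        rw [← unitNodes_succ'] at hy'
        linarith [(mem_Icc_of_mem_unitNodes_succ hy').2]
    exact hyM.trans (mem_Ico_of_mem_unitNodes hz).1

lemma ConvexOfOrderOn.abs_rho_succ_le {p : ℕ} {g : ℝ → ℝ} {a : ℝ}
    (hg : ConvexOfOrderOn p g (Ioi a)) {k M x : ℝ} (hk : a < k) (hpM : p ≤ M)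
    (hx : x ∈ Icc 0 M) :
    |rho (p + 1) k g x| ≤ M ^ p * ((Δ_[1])^[p] g (k + M) - (Δ_[1])^[p] g k) := by
  have hM : 0 ≤ M := hx.1.trans hx.2
  by_cases hnode : x + k ∈ unitNodes k (p + 1)
  · obtain ⟨i, hi, hix⟩ := mem_unitNodes.1 hnode
    obtain rfl : x = i := by linarith
    rw [rho_natCast_eq_zero hi, abs_zero]
    exact mul_nonneg (by positivity) (sub_nonneg.2 (hg.monotoneOn_fwdDiff_iter hk
      (hk.trans_le (le_add_of_nonneg_right hM)) (le_add_of_nonneg_right hM)))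
  have hxk : x + k ∉ unitNodes (k + 1) p := fun h =>
    hnode (by rw [unitNodes_succ']; exact Finset.mem_insert_of_mem h)
  obtain ⟨hlow, hhigh⟩ := hg.divDiff_insert_unitNodes_mem_Icc hk hpM hx hxk
  have hprod : |∏ j ∈ Finset.range p, (x - (j + 1 : ℕ))| ≤ M ^ p := by
    rw [Finset.abs_prod]
    refine (Finset.prod_le_prod (g := fun _ => M) (fun _ _ => abs_nonneg _)
      fun j hj => ?_).trans_eq (by simp)
    have hjp : ((j + 1 : ℕ) : ℝ) ≤ p := by exact_mod_cast Finset.mem_range.1 hj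
    exact abs_le.2 ⟨by linarith [hx.1], by linarith [hx.2, (j + 1).cast_nonneg (α := ℝ)]⟩
  have hfact : (1 : ℝ) ≤ p.factorial := by exact_mod_cast p.factorial_pos
  rw [rho_succ_eq_prod_mul_sub hnode, abs_mul, fwdDiff_iter_eq_factorial_mul_divDiff,
    fwdDiff_iter_eq_factorial_mul_divDiff, ← mul_sub, abs_of_nonneg (sub_nonneg.2 hlow)]
  refine mul_le_mul hprod ?_ (sub_nonneg.2 hlow) (by positivity)
  exact (sub_le_sub_right hhigh _).trans
    (le_mul_of_one_le_left (sub_nonneg.2 (hlow.trans hhigh)) hfact)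

lemma fwdDiff_iter_neg (g : ℝ → ℝ) (n : ℕ) : (Δ_[1])^[n] (-g) = -(Δ_[1])^[n] g := by
  simpa using fwdDiff_iter_const_smul (1 : ℝ) (-1 : ℝ) g n

lemma rho_neg (p : ℕ) (a : ℝ) (g : ℝ → ℝ) (x : ℝ) : rho p a (-g) x = -rho p a g x := by
  simp only [rho, fwdDiff_iter_neg, Pi.neg_apply, mul_neg, Finset.sum_neg_distrib]
  ring

lemma InDNat.neg {p : ℕ} {g : ℝ → ℝ} (h : InDNat p g) : InDNat p (-g) := by
  simpa [InDNat, fwdDiff_iter_neg] using Tendsto.neg h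

lemma InK.neg {p : ℕ} {g : ℝ → ℝ} (h : InK p g) : InK p (-g) := by
  simp only [InK, concaveOfOrderOn_iff_convexOfOrderOn_neg, neg_neg] at h ⊢
  exact h.symm

lemma InDK.neg {p : ℕ} {g : ℝ → ℝ} (h : InDK p g) : InDK p (-g) := ⟨h.1.neg, h.2.neg⟩

lemma InDK.exists_convexOfOrderOn {p : ℕ} {g : ℝ → ℝ} (h : InDK p g) :
    ∃ a : ℝ, 0 < a ∧ (ConvexOfOrderOn p g (Ioi a) ∨ ConvexOfOrderOn p (-g) (Ioi a)) := by
  rcases h.2 with ⟨a, ha, hc⟩ | ⟨a, ha, hc⟩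
  · exact ⟨a, ha, Or.inl hc⟩
  · exact ⟨a, ha, Or.inr (concaveOfOrderOn_iff_convexOfOrderOn_neg.1 hc)⟩

lemma InDNat.mono {p q : ℕ} {g : ℝ → ℝ} (h : InDNat p g) (hpq : p ≤ q) : InDNat q g := by
  induction q, hpq using Nat.le_induction with
  | base => exact h
  | succ q _ ih =>
    simpa [InDNat, Function.iterate_succ_apply', fwdDiff] using
      ((tendsto_add_atTop_iff_nat 1).2 ih).sub ih

lemma InDK.inDReal {p : ℕ} {g : ℝ → ℝ} (h : InDK p g) : InDReal p g := by
  have hconvex {f : ℝ → ℝ} {a : ℝ} (hD : InDNat p f) (hc : ConvexOfOrderOn p f (Ioi a)) :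
      InDReal p f := by
    have hmono := hc.monotoneOn_fwdDiff_iter
    refine tendsto_of_tendsto_of_tendsto_of_le_of_le' (hD.comp tendsto_nat_floor_atTop)
      (hD.comp tendsto_nat_ceil_atTop) ?_ ?_
    · filter_upwards [tendsto_nat_floor_atTop.eventually
        (tendsto_natCast_atTop_atTop.eventually_gt_atTop a), eventually_ge_atTop 0] with x hx hx₀
      exact hmono hx (hx.trans_le (Nat.floor_le hx₀)) (Nat.floor_le hx₀)
    · filter_upwards [eventually_gt_atTop a] with x hx
      exact hmono hx (hx.trans_le (Nat.le_ceil x)) (Nat.le_ceil x)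
  obtain ⟨a, -, hc | hc⟩ := h.exists_convexOfOrderOn
  · exact hconvex h.1 hc
  · simpa [InDReal, fwdDiff_iter_neg] using (hconvex h.neg.1 hc).neg

section Summability

lemma summable_succ_sub_of_tendsto {φ : ℕ → ℝ} {L : ℝ} (hφ : Tendsto φ atTop (𝓝 L)) {N : ℕ}
    (hmono : MonotoneOn φ (Ici N)) : Summable fun n => φ (n + 1) - φ n := by
  rw [← summable_nat_add_iff N]
  refine ⟨L - φ N, (hasSum_iff_tendsto_nat_of_nonneg (fun n => sub_nonneg.2 ?_) _).2 ?_⟩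
  · exact hmono (Nat.le_add_left N n) (by simp; lia) (Nat.le_succ _)
  · have htele (n : ℕ) :
        ∑ i ∈ Finset.range n, (φ (i + N + 1) - φ (i + N)) = φ (n + N) - φ N := by
      simpa [add_right_comm] using Finset.sum_range_sub (fun i => φ (i + N)) n
    simp_rw [htele]
    exact ((tendsto_add_atTop_iff_nat N).2 hφ).sub_const _

lemma summable_add_sub_of_tendsto {φ : ℕ → ℝ} {L : ℝ} (hφ : Tendsto φ atTop (𝓝 L)) {N : ℕ}
    (hmono : MonotoneOn φ (Ici N)) (m : ℕ) : Summable fun n => φ (n + m) - φ n := by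
  induction m with
  | zero => simp
  | succ m ih =>
    have hsucc := (summable_nat_add_iff m).2 (summable_succ_sub_of_tendsto hφ hmono)
    exact (hsucc.add ih).congr fun n => by rw [← add_assoc, sub_add_sub_cancel]

lemma eulerTerm_eq_rho (p : ℕ) (g : ℝ → ℝ) (k : ℕ) : eulerTerm p g k = rho (p + 1) k g := rfl

lemma ConvexOfOrderOn.exists_summable_bound {p : ℕ} {g : ℝ → ℝ} {a : ℝ}
    (hc : ConvexOfOrderOn p g (Ioi a)) (hD : InDNat p g) (b : ℝ) :
    ∃ u : ℕ → ℝ, Summable u ∧ ∀ᶠ k in atTop, ∀ x ∈ Icc 0 b, |eulerTerm p g k x| ≤ u k := by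
  obtain ⟨M, hM⟩ := exists_nat_ge (max b p)
  obtain ⟨N, hN⟩ := exists_nat_gt a
  have hIoi {n : ℕ} (hn : N ≤ n) : a < n := hN.trans_le (by exact_mod_cast hn)
  have hmono : MonotoneOn (fun n : ℕ => (Δ_[1])^[p] g n) (Ici N) := fun m hm n hn hmn =>
    hc.monotoneOn_fwdDiff_iter (hIoi hm) (hIoi hn) (by exact_mod_cast hmn)
  refine ⟨_, (summable_add_sub_of_tendsto hD hmono M).mul_left ((M : ℝ) ^ p), ?_⟩
  filter_upwards [eventually_ge_atTop N] with k hk x hx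
  rw [Nat.cast_add]
  exact hc.abs_rho_succ_le (hIoi hk) ((le_max_right _ _).trans hM)
    ⟨hx.1, hx.2.trans ((le_max_left _ _).trans hM)⟩

lemma InDK.exists_summable_bound {p : ℕ} {g : ℝ → ℝ} (hg : InDK p g) (b : ℝ) :
    ∃ u : ℕ → ℝ, Summable u ∧ ∀ᶠ k in atTop, ∀ x ∈ Icc 0 b, |eulerTerm p g k x| ≤ u k := by
  obtain ⟨a, -, hc | hc⟩ := hg.exists_convexOfOrderOn
  · exact hc.exists_summable_bound hg.1 b
  · simpa only [eulerTerm_eq_rho, rho_neg, abs_neg] using hc.exists_summable_bound hg.1.neg b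

/-- The sum of the Eulerian series. -/
def eulerSum (p : ℕ) (g : ℝ → ℝ) (x : ℝ) : ℝ := ∑' k, eulerTerm p g (k + 1) x

lemma sum_Icc_one_eq_sum_range {M : Type*} [AddCommMonoid M] (f : ℕ → M) (n : ℕ) :
    ∑ k ∈ Finset.Icc 1 n, f k = ∑ k ∈ Finset.range n, f (k + 1) := by
  rw [Finset.range_eq_Ico, Finset.sum_Ico_add' f 0 n 1]
  rfl

lemma InDK.sumsUniformlyOnBounded_eulerTerm {p : ℕ} {g : ℝ → ℝ} (hg : InDK p g) :
    SumsUniformlyOnBounded (Ici 0) (eulerTerm p g) (eulerSum p g) := by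
  intro E hE hb
  obtain ⟨b, hb⟩ := hb.bddAbove
  obtain ⟨u, hu, h⟩ := hg.exists_summable_bound b
  simp only [sum_Icc_one_eq_sum_range]
  refine tendstoUniformlyOn_tsum_nat_eventually (f := fun k x => eulerTerm p g (k + 1) x)
    ((summable_nat_add_iff 1).2 hu) ?_
  filter_upwards [(tendsto_add_atTop_nat 1).eventually h] with k hk x hx
  exact hk x ⟨hE hx, hb hx⟩

end Summability

section Derivative

lemma hasDerivAt_fwdDiff_iter {f f' : ℝ → ℝ} {a : ℝ} (h : ∀ x ∈ Ioi a, HasDerivAt f (f' x) x)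
    (n : ℕ) : ∀ x ∈ Ioi a, HasDerivAt ((Δ_[1])^[n] f) ((Δ_[1])^[n] f' x) x := by
  induction n with
  | zero => exact h
  | succ n ih =>
    intro x hx
    rw [Function.iterate_succ_apply', Function.iterate_succ_apply']
    have hx1 : x + 1 ∈ Ioi a := mem_Ioi.2 (lt_add_of_lt_of_pos hx one_pos)
    exact ((ih (x + 1) hx1).comp_add_const x 1).sub (ih x hx)

lemma divDiff_image_add {F : Type*} [Field F] [DecidableEq F] (f : F → F) (s : Finset F) (h : F) :
    divDiff f (s.image (· + h)) = divDiff (fun x => f (x + h)) s := by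
  have hinj : Function.Injective (· + h : F → F) := add_left_injective h
  rw [divDiff, Finset.sum_image hinj.injOn]
  refine Finset.sum_congr rfl fun x _ => ?_
  rw [← Finset.image_erase hinj, Finset.prod_image hinj.injOn]
  simp

lemma hasDerivAt_divDiff_add {g : ℝ → ℝ} {s : Finset ℝ} (hg : ∀ x ∈ s, DifferentiableAt ℝ g x) :
    HasDerivAt (fun h => divDiff (fun x => g (x + h)) s) (divDiff (deriv g) s) 0 := by
  refine HasDerivAt.fun_sum fun x hx => HasDerivAt.div_const ?_ _
  have hx' : HasDerivAt g (deriv g x) (x + 0) := by simpa using (hg x hx).hasDerivAt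
  exact hx'.comp_const_add x 0

protected lemma ConvexOfOrderOn.deriv {p : ℕ} {g : ℝ → ℝ} {a : ℝ}
    (hg : ConvexOfOrderOn (p + 1) g (Ioi a)) (hd : DifferentiableOn ℝ g (Ioi a)) :
    ConvexOfOrderOn p (deriv g) (Ioi a) := by
  rw [convexOfOrderOn_iff]
  intro s hs hsI
  have hder := hasDerivAt_divDiff_add fun x hx => hd.differentiableAt (Ioi_mem_nhds (hsI hx))
  refine ge_of_tendsto hder.tendsto_slope_zero_right ?_
  filter_upwards [self_mem_nhdsWithin] with h (hpos : 0 < h)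
  have hshift := hg.divDiff_le_divDiff_image_add hs hsI hpos.le
    fun x hx => lt_add_of_lt_of_pos (hsI hx) hpos
  rw [divDiff_image_add] at hshift
  simpa using mul_nonneg (inv_nonneg.2 hpos.le) (sub_nonneg.2 hshift)

/-- By the mean value theorem, `Δ^p g'` takes the value `Δ^{p+1} g(n)` between `n` and `n + 1`. -/
lemma ConvexOfOrderOn.inDNat_deriv {p : ℕ} {g : ℝ → ℝ} {a : ℝ}
    (hg : ConvexOfOrderOn (p + 1) g (Ioi a)) (hd : DifferentiableOn ℝ g (Ioi a))
    (hD : InDNat (p + 1) g) : InDNat p (deriv g) := by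
  have hmono := (hg.deriv hd).monotoneOn_fwdDiff_iter
  have hder := hasDerivAt_fwdDiff_iter
    (fun x hx => (hd.differentiableAt (Ioi_mem_nhds hx)).hasDerivAt) p
  have mvt {x : ℝ} (hx : a < x) : ∃ c ∈ Ioo x (x + 1),
      (Δ_[1])^[p] (deriv g) c = (Δ_[1])^[p + 1] g x := by
    obtain ⟨c, hc, hslope⟩ := exists_hasDerivAt_eq_slope ((Δ_[1])^[p] g) _ (lt_add_one x)
      (fun y hy => (hder y (hx.trans_le hy.1)).continuousAt.continuousWithinAt)
      (fun y hy => hder y (hx.trans hy.1))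
    refine ⟨c, hc, ?_⟩
    rw [hslope, Function.iterate_succ_apply', fwdDiff, add_sub_cancel_left, div_one]
  rw [InDNat, ← tendsto_add_atTop_iff_nat 1]
  refine tendsto_of_tendsto_of_tendsto_of_le_of_le' hD ((tendsto_add_atTop_iff_nat 1).2 hD) ?_ ?_
  all_goals
    filter_upwards [tendsto_natCast_atTop_atTop.eventually_gt_atTop a] with n hn
    have hn1 : a < ((n + 1 : ℕ) : ℝ) := hn.trans (by exact_mod_cast n.lt_succ_self)
  · obtain ⟨c, hc, hval⟩ := mvt hn
    rw [← hval]
    exact hmono (hn.trans hc.1) hn1 (by exact_mod_cast hc.2.le)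
  · obtain ⟨c, hc, hval⟩ := mvt hn1
    rw [← hval]
    exact hmono hn1 (hn1.trans hc.1) hc.1.le

protected lemma InDK.deriv {p : ℕ} {g : ℝ → ℝ} (hg : InDK (p + 1) g)
    (hd : DifferentiableOn ℝ g (Ioi 0)) : InDK p (deriv g) := by
  obtain ⟨a, ha, hc | hc⟩ := hg.exists_convexOfOrderOn
  · have hda := hd.mono (Ioi_subset_Ioi ha.le)
    exact ⟨hc.inDNat_deriv hda hg.1, Or.inl ⟨a, ha, hc.deriv hda⟩⟩
  · have hda := hd.neg.mono (Ioi_subset_Ioi ha.le)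
    have hneg : InDK p (deriv (-g)) :=
      ⟨hc.inDNat_deriv hda hg.1.neg, Or.inl ⟨a, ha, hc.deriv hda⟩⟩
    have hder : deriv (-g) = -deriv g := funext fun x => deriv.neg
    simpa [hder] using hneg.neg

lemma inC_succ_iff {r : ℕ} {f : ℝ → ℝ} :
    InC (r + 1) f ↔ DifferentiableOn ℝ f (Ioi 0) ∧ InC r (deriv f) := by
  simpa [InC] using contDiffOn_succ_iff_deriv_of_isOpen (n := r) (f := f) isOpen_Ioi

protected lemma InDK.iteratedDeriv {p r : ℕ} {g : ℝ → ℝ} (hg : InDK (p + r) g) (hC : InC r g) :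
    InDK p (iteratedDeriv r g) := by
  induction r generalizing g with
  | zero => simpa using hg
  | succ r ih =>
    obtain ⟨hd, hC'⟩ := inC_succ_iff.1 hC
    rw [iteratedDeriv_succ']
    exact ih (InDK.deriv hg hd) hC'

end Derivative

section Sums

variable {A B : Set ℝ} {u v : ℕ → ℝ → ℝ} {S T : ℝ → ℝ}

lemma SumsUniformlyOnBounded.mono (h : SumsUniformlyOnBounded A u S) (hBA : B ⊆ A) :
    SumsUniformlyOnBounded B u S := fun E hE hb => h E (hE.trans hBA) hb

lemma SumsUniformlyOnBounded.congr (h : SumsUniformlyOnBounded A u S)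
    (huv : ∀ k, 1 ≤ k → EqOn (u k) (v k) A) (hST : EqOn S T A) :
    SumsUniformlyOnBounded A v T := fun E hE hb =>
  ((h E hE hb).congr (Eventually.of_forall fun _ _ hx => Finset.sum_congr rfl fun k hk =>
    huv k (Finset.mem_Icc.1 hk).1 (hE hx))).congr_right fun _ hx => hST (hE hx)

lemma SumsUniformlyOnBounded.tendsto (h : SumsUniformlyOnBounded A u S) {x : ℝ} (hx : x ∈ A) :
    Tendsto (fun n => ∑ k ∈ Finset.Icc 1 n, u k x) atTop (𝓝 (S x)) :=
  (h {x} (singleton_subset_iff.2 hx) Bornology.isBounded_singleton).tendsto_at (mem_singleton x)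

lemma SumsUniformlyOnBounded.add (h : SumsUniformlyOnBounded A u S)
    (h' : SumsUniformlyOnBounded A v T) :
    SumsUniformlyOnBounded A (fun k x => u k x + v k x) (fun x => S x + T x) := by
  intro E hE hb
  simp only [Finset.sum_add_distrib]
  exact (h E hE hb).add (h' E hE hb)

lemma sumsUniformlyOnBounded_const_mul {c : ℕ → ℝ} {C : ℝ} {b : ℝ → ℝ}
    (hc : Tendsto (fun n => ∑ k ∈ Finset.Icc 1 n, c k) atTop (𝓝 C)) (hb : Continuous b) :
    SumsUniformlyOnBounded univ (fun k x => c k * b x) (fun x => C * b x) := by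
  intro E _ hE V hV
  obtain ⟨W, hW, h⟩ := hE.isCompact_closure.mem_uniformity_of_prod (s := univ)
    (f := fun c x => c * b x) (by fun_prop) (mem_univ C) (symm_le_uniformity hV)
  rw [nhdsWithin_univ] at hW
  filter_upwards [hc.eventually hW] with n hn x hx
  simp only [← Finset.sum_mul]
  exact h _ hn x (subset_closure hx)

lemma sumsUniformlyOnBounded_finsetSum {ι : Type*} {s : Finset ι} {u : ι → ℕ → ℝ → ℝ}
    {S : ι → ℝ → ℝ} (h : ∀ i ∈ s, SumsUniformlyOnBounded A (u i) (S i)) :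
    SumsUniformlyOnBounded A (fun k x => ∑ i ∈ s, u i k x) (fun x => ∑ i ∈ s, S i x) := by
  classical
  induction s using Finset.induction_on with
  | empty =>
    intro E _ _ V hV
    simp [refl_mem_uniformity hV]
  | insert a s ha ih =>
    simp only [Finset.sum_insert ha]
    exact (h a (Finset.mem_insert_self a s)).add
      (ih fun i hi => h i (Finset.mem_insert_of_mem hi))

lemma SumsUniformlyOnBounded.continuousOn (h : SumsUniformlyOnBounded (Ici 0) u S)
    (hu : ∀ k, 1 ≤ k → ContinuousOn (u k) (Ici 0)) : ContinuousOn S (Ici 0) := by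
  intro x hx
  have hunif := h (Icc 0 (x + 1)) Icc_subset_Ici_self (Metric.isBounded_Icc _ _)
  have hcont : ContinuousOn S (Icc 0 (x + 1)) := hunif.continuousOn (Frequently.of_forall fun n =>
    continuousOn_finsetSum _ fun k hk =>
      (hu k (Finset.mem_Icc.1 hk).1).mono Icc_subset_Ici_self)
  refine (hcont x ⟨hx, by linarith⟩).mono_of_mem_nhdsWithin ?_
  rw [← Ici_inter_Iic]
  exact inter_mem_nhdsWithin _ (Iic_mem_nhds (lt_add_one x))

lemma intervalIntegrable_of_continuousOn_Ici {f : ℝ → ℝ} {c : ℝ} (hf : ContinuousOn f (Ici c))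
    {a b : ℝ} (ha : c ≤ a) (hb : c ≤ b) : IntervalIntegrable f volume a b :=
  (hf.mono fun _ hx => (le_min ha hb).trans hx.1).intervalIntegrable

lemma continuousOn_primitive_Ici {f : ℝ → ℝ} {c : ℝ} (hf : ContinuousOn f (Ici c)) {a : ℝ}
    (ha : c ≤ a) : ContinuousOn (fun x => ∫ t in a..x, f t) (Ici c) := by
  have hc : Continuous fun x => f (max x c) :=
    hf.comp_continuous (by fun_prop) fun x => le_max_right x c
  refine (intervalIntegral.continuous_primitive (μ := volume)
    (fun a b => hc.intervalIntegrable a b) a).continuousOn.congr fun x hx => ?_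
  refine intervalIntegral.integral_congr fun t ht => ?_
  rw [max_eq_left ((le_min ha hx).trans ht.1)]

lemma SumsUniformlyOnBounded.primitive (h : SumsUniformlyOnBounded (Ici 0) u S)
    (hu : ∀ k, 1 ≤ k → ContinuousOn (u k) (Ici 0)) {a : ℝ} (ha : 0 ≤ a) :
    SumsUniformlyOnBounded (Ici 0) (fun k x => ∫ t in a..x, u k t) (fun x => ∫ t in a..x, S t) := by
  have hS := h.continuousOn hu
  intro E hE hb
  obtain ⟨b, hb⟩ := hb.bddAbove
  set M := max a b
  have hM : 0 ≤ M := ha.trans (le_max_left a b)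
  rw [Metric.tendstoUniformlyOn_iff]
  intro ε hε
  filter_upwards [Metric.tendstoUniformlyOn_iff.1
    (h (Icc 0 M) Icc_subset_Ici_self (Metric.isBounded_Icc _ _)) (ε / (M + 1)) (by positivity)]
    with n hn x hx
  have hx₀ : 0 ≤ x := hE hx
  have hxM : x ≤ M := (hb hx).trans (le_max_right a b)
  have haM : a ≤ M := le_max_left a b
  have hint : ∀ k ∈ Finset.Icc 1 n, IntervalIntegrable (u k) volume a x := fun k hk =>
    intervalIntegrable_of_continuousOn_Ici (hu k (Finset.mem_Icc.1 hk).1) ha hx₀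
  have hlen : |x - a| < M + 1 := by rw [abs_lt]; constructor <;> linarith
  rw [← intervalIntegral.integral_finsetSum hint, Real.dist_eq, ← intervalIntegral.integral_sub
    (intervalIntegrable_of_continuousOn_Ici hS ha hx₀) (by
      simpa only [Finset.sum_fn] using IntervalIntegrable.sum _ hint)]
  calc ‖∫ t in a..x, (S t - ∑ k ∈ Finset.Icc 1 n, u k t)‖ ≤ ε / (M + 1) * |x - a| := by
        refine intervalIntegral.norm_integral_le_of_norm_le_const fun t ht => ?_
        have ht := uIoc_subset_uIcc ht
        exact (hn t ⟨(le_min ha hx₀).trans ht.1, ht.2.trans (max_le haM hxM)⟩).le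
    _ < ε / (M + 1) * (M + 1) := by gcongr
    _ = ε := by field_simp

protected lemma SumsUniformlyOnBounded.iterInt (h : SumsUniformlyOnBounded (Ici 0) u S)
    (hu : ∀ k, 1 ≤ k → ContinuousOn (u k) (Ici 0)) {l : List ℝ} (hl : ∀ a ∈ l, 0 ≤ a) :
    (∀ k, 1 ≤ k → ContinuousOn (iterInt l (u k)) (Ici 0)) ∧
      SumsUniformlyOnBounded (Ici 0) (fun k => iterInt l (u k)) (iterInt l S) := by
  induction l with
  | nil => exact ⟨hu, h⟩
  | cons a l ih =>
    obtain ⟨ha, hl⟩ := List.forall_mem_cons.1 hl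
    obtain ⟨hcont, hsum⟩ := ih hl
    exact ⟨fun k hk => continuousOn_primitive_Ici (hcont k hk) ha, hsum.primitive hcont ha⟩

lemma SumsUniformlyOnBounded.integrableTermwise (h : SumsUniformlyOnBounded (Ici 0) u S)
    (hu : ∀ k, 1 ≤ k → ContinuousOn (u k) (Ici 0)) : IntegrableTermwise u S :=
  ⟨hu, h.continuousOn hu, fun _ hl => (h.iterInt hu hl).2⟩

lemma inC_zero_iff {f : ℝ → ℝ} : InC 0 f ↔ ContinuousOn f (Ioi 0) := by
  simp [InC, contDiffOn_zero]

lemma InC.mono {r s : ℕ} {f : ℝ → ℝ} (h : InC r f) (hs : s ≤ r) : InC s f :=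
  ContDiffOn.of_le h (by exact_mod_cast hs)

lemma inC_succ_of_hasDerivAt {r : ℕ} {f f' : ℝ → ℝ} (h : ∀ x ∈ Ioi 0, HasDerivAt f (f' x) x)
    (hf' : InC r f') : InC (r + 1) f :=
  inC_succ_iff.2 ⟨fun x hx => (h x hx).differentiableAt.differentiableWithinAt,
    ContDiffOn.congr hf' fun x hx => (h x hx).deriv⟩

lemma SumsUniformlyOnBounded.hasDerivAt (hv : SumsUniformlyOnBounded (Ioi 0) v T)
    (huv : ∀ k, 1 ≤ k → ∀ x ∈ Ioi 0, HasDerivAt (u k) (v k x) x)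
    (hS : SumsUniformlyOnBounded (Ioi 0) u S) : ∀ x ∈ Ioi 0, HasDerivAt S (T x) x := by
  intro x hx
  refine hasDerivAt_of_tendstoUniformlyOn isOpen_Ioo
    (hv (Ioo 0 (x + 1)) Ioo_subset_Ioi_self (Metric.isBounded_Ioo _ _))
    (Eventually.of_forall fun n y hy => ?_) (fun y hy => hS.tendsto hy.1) ⟨hx, lt_add_one x⟩
  exact HasDerivAt.fun_sum fun k hk => huv k (Finset.mem_Icc.1 hk).1 y hy.1

lemma DifferentiableTermwise.of_hasDerivAt {r : ℕ}
    (huv : ∀ k, 1 ≤ k → ∀ x ∈ Ioi 0, HasDerivAt (u k) (v k x) x)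
    (hS : SumsUniformlyOnBounded (Ioi 0) u S) (hv : DifferentiableTermwise r v T) :
    DifferentiableTermwise (r + 1) u S := by
  obtain ⟨hCv, hCT, hsum⟩ := hv
  have hST := SumsUniformlyOnBounded.hasDerivAt (by simpa using hsum 0 r.zero_le) huv hS
  have hiter {f f' : ℝ → ℝ} (h : ∀ x ∈ Ioi 0, HasDerivAt f (f' x) x) (j : ℕ) :
      EqOn (iteratedDeriv j f') (iteratedDeriv (j + 1) f) (Ioi 0) := by
    rw [iteratedDeriv_succ']
    exact EqOn.iteratedDeriv_of_isOpen (fun x hx => (h x hx).deriv.symm) isOpen_Ioi j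
  refine ⟨fun k hk => inC_succ_of_hasDerivAt (huv k hk) (hCv k hk),
    inC_succ_of_hasDerivAt hST hCT, fun j hj => ?_⟩
  rcases j with _ | j
  · simpa using hS
  · exact (hsum j (Nat.le_of_succ_le_succ hj)).congr (fun k hk => hiter (huv k hk) j) (hiter hST j)

end Sums

section Polynomials

open Polynomial

/-- The linear map `L` allows one to conclude for the series of derivatives as well. -/
lemma exists_polynomial_sum {d : ℕ} {q : ℕ → ℝ[X]} (hd : ∀ k, (q k).natDegree ≤ d)
    (h : ∀ i : ℕ, ∃ l, Tendsto (fun n => ∑ k ∈ Finset.Icc 1 n, (q k).eval (i : ℝ)) atTop (𝓝 l)) :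
    ∃ Q : ℝ[X], ∀ L : ℝ[X] →ₗ[ℝ] ℝ[X],
      SumsUniformlyOnBounded univ (fun k x => (L (q k)).eval x) (fun x => (L Q).eval x) := by
  choose l hl using h
  set b := Lagrange.basis (Finset.range (d + 1)) (fun i : ℕ => (i : ℝ))
  have hq (k : ℕ) : q k = ∑ i ∈ Finset.range (d + 1), (q k).eval (i : ℝ) • b i := by
    have hdeg : (q k).degree < (Finset.range (d + 1)).card := by
      rw [Finset.card_range, degree_lt_iff_coeff_zero]
      exact fun m hm => coeff_eq_zero_of_natDegree_lt ((hd k).trans_lt (by exact_mod_cast hm))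
    simpa only [Lagrange.interpolate_apply, C_mul'] using
      Lagrange.eq_interpolate Nat.cast_injective.injOn hdeg
  refine ⟨∑ i ∈ Finset.range (d + 1), l i • b i, fun L => ?_⟩
  refine (sumsUniformlyOnBounded_finsetSum fun i (_ : i ∈ Finset.range (d + 1)) =>
    sumsUniformlyOnBounded_const_mul (hl i) (L (b i)).continuous).congr
    (fun k _ x _ => ?_) (fun x _ => ?_)
  · conv_rhs => rw [hq k]
    simp [eval_finsetSum]
  · simp [eval_finsetSum]

lemma exists_derivative_eq (p : ℝ[X]) :
    ∃ F : ℝ[X], derivative F = p ∧ F.natDegree ≤ p.natDegree + 1 := by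
  refine ⟨∑ i ∈ Finset.range (p.natDegree + 1), monomial (i + 1) (p.coeff i / (i + 1)), ?_, ?_⟩
  · conv_rhs => rw [p.as_sum_range]
    rw [derivative_sum]
    refine Finset.sum_congr rfl fun i _ => ?_
    rw [derivative_monomial, Nat.add_sub_cancel, Nat.cast_add_one,
      div_mul_cancel₀ _ i.cast_add_one_ne_zero]
  · exact natDegree_sum_le_of_forall_le _ _ fun i hi =>
      (natDegree_monomial_le _).trans (Finset.mem_range.1 hi)

variable {d : ℕ} {u v : ℕ → ℝ → ℝ} {q : ℕ → ℝ[X]} {S T : ℝ → ℝ}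

lemma SumsUniformlyOnBounded.add_polynomial (hv : SumsUniformlyOnBounded (Ici 0) v T)
    (hd : ∀ k, (q k).natDegree ≤ d)
    (h : ∀ x, 0 ≤ x →
      Tendsto (fun n => ∑ k ∈ Finset.Icc 1 n, (v k x + (q k).eval x)) atTop (𝓝 (S x))) :
    SumsUniformlyOnBounded (Ici 0) (fun k x => v k x + (q k).eval x) S := by
  obtain ⟨Q, hQ⟩ := exists_polynomial_sum hd fun i => ⟨_, by
    simpa [Finset.sum_add_distrib] using
      (h i i.cast_nonneg).sub (hv.tendsto (mem_Ici.2 i.cast_nonneg))⟩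
  have hsum := hv.add ((hQ LinearMap.id).mono (subset_univ (Ici 0)))
  exact hsum.congr (fun _ _ => eqOn_refl _ _) fun x hx =>
    tendsto_nhds_unique (hsum.tendsto hx) (h x hx)

/-- Up to constants, `∑ u k` and `∑ ∫ v k` determine the series of antiderivatives of the `q k`,
which therefore converges and can be differentiated. -/
lemma SumsUniformlyOnBounded.exists_add_polynomial_of_hasDerivAt
    (hv : SumsUniformlyOnBounded (Ici 0) v T) (hvc : ∀ k, 1 ≤ k → ContinuousOn (v k) (Ici 0))
    (hd : ∀ k, (q k).natDegree ≤ d)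
    (huv : ∀ k, 1 ≤ k → ∀ x, 0 ≤ x → HasDerivAt (u k) (v k x + (q k).eval x) x)
    (hu : ∀ x, 0 ≤ x → Tendsto (fun n => ∑ k ∈ Finset.Icc 1 n, u k x) atTop (𝓝 (S x))) :
    ∃ T', SumsUniformlyOnBounded (Ici 0) (fun k x => v k x + (q k).eval x) T' := by
  choose F hF hFdeg using fun k => exists_derivative_eq (q k)
  have hint (k : ℕ) (hk : 1 ≤ k) (x : ℝ) (hx : 0 ≤ x) :
      (F k - C ((F k).eval 0)).eval x = u k x - u k 0 - ∫ t in (0 : ℝ)..x, v k t := by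
    have hder : ∀ t ∈ uIcc 0 x, HasDerivAt (fun t => u k t - (F k).eval t) (v k t) t := by
      intro t ht
      rw [uIcc_of_le hx] at ht
      simpa [hF] using (huv k hk t ht.1).fun_sub ((F k).hasDerivAt t)
    rw [intervalIntegral.integral_eq_sub_of_hasDerivAt hder
      (intervalIntegrable_of_continuousOn_Ici (hvc k hk) le_rfl hx), eval_sub, eval_C]
    ring
  have hdeg (k : ℕ) : (F k - C ((F k).eval 0)).natDegree ≤ d + 1 := by
    rw [natDegree_sub_C]
    exact (hFdeg k).trans (Nat.succ_le_succ (hd k))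
  obtain ⟨Q, hQ⟩ := exists_polynomial_sum hdeg fun i => by
    have hi : (0 : ℝ) ≤ i := i.cast_nonneg
    refine ⟨_, (((hu i hi).sub (hu 0 le_rfl)).sub
      ((hv.primitive hvc le_rfl).tendsto (mem_Ici.2 hi))).congr fun n => ?_⟩
    rw [← Finset.sum_sub_distrib, ← Finset.sum_sub_distrib]
    exact Finset.sum_congr rfl fun k hk => (hint k (Finset.mem_Icc.1 hk).1 i hi).symm
  have hsum := hv.add ((hQ derivative).mono (subset_univ (Ici 0)))
  simp only [derivative_sub, derivative_C, sub_zero, hF] at hsum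
  exact ⟨_, hsum⟩

lemma iteratedDeriv_polynomial_eval (P : ℝ[X]) (n : ℕ) :
    iteratedDeriv n (fun x => P.eval x) = fun x => (derivative^[n] P).eval x := by
  induction n with
  | zero => simp
  | succ n ih =>
    rw [iteratedDeriv_succ, ih, Function.iterate_succ_apply']
    exact funext fun x => Polynomial.deriv _

lemma contDiff_polynomial_eval (P : ℝ[X]) (n : WithTop ℕ∞) : ContDiff ℝ n fun x => P.eval x := by
  simpa using P.contDiff_aeval (𝕜 := ℝ) n

end Polynomials

section ShiftSeries

open Polynomial

variable {p d r : ℕ} {g S : ℝ → ℝ} {P : ℕ → ℝ[X]}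

/-- The terms `g (x + k) - P k x`, with polynomials `P k`, of a series of shifts of `g`. The
Eulerian and the Weierstrassian series are of this form. -/
def shiftTerm (g : ℝ → ℝ) (P : ℕ → ℝ[X]) (k : ℕ) (x : ℝ) : ℝ := g (x + k) - (P k).eval x

lemma continuousOn_shiftTerm (hg : InC 0 g) {k : ℕ} (hk : 1 ≤ k) :
    ContinuousOn (shiftTerm g P k) (Ici 0) := by
  refine ((inC_zero_iff.1 hg).comp (by fun_prop) fun x hx => ?_).sub (P k).continuous.continuousOn
  exact add_pos_of_nonneg_of_pos (mem_Ici.1 hx) (by exact_mod_cast hk)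

/-- The polynomial part of `eulerTerm p g k`, by which `g (x + k)` is interpolated at
`0, 1, …, p`. -/
def eulerPoly (p : ℕ) (g : ℝ → ℝ) (k : ℕ) : ℝ[X] := newtonPoly (fun j => (Δ_[1])^[j] g k) (p + 1)

lemma eulerTerm_eq_shiftTerm (p : ℕ) (g : ℝ → ℝ) : eulerTerm p g = shiftTerm g (eulerPoly p g) := by
  ext k x
  rw [eulerTerm_eq_rho, rho_eq_sub_eval_newtonPoly, shiftTerm, eulerPoly]

lemma natDegree_eulerPoly_le (p : ℕ) (g : ℝ → ℝ) (k : ℕ) : (eulerPoly p g k).natDegree ≤ p :=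
  natDegree_newtonPoly_succ_le _ p

lemma shiftTerm_eq_eulerTerm_add (p : ℕ) (g : ℝ → ℝ) (P : ℕ → ℝ[X]) (k : ℕ) (x : ℝ) :
    shiftTerm g P k x = eulerTerm p g k x + (eulerPoly p g k - P k).eval x := by
  rw [eulerTerm_eq_shiftTerm, shiftTerm, shiftTerm, eval_sub]
  ring

lemma natDegree_eulerPoly_sub_le (hP : ∀ k, (P k).natDegree ≤ d) (k : ℕ) :
    (eulerPoly p g k - P k).natDegree ≤ max p d :=
  (natDegree_sub_le _ _).trans (max_le_max (natDegree_eulerPoly_le p g k) (hP k))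

lemma InDK.sumsUniformlyOnBounded_shiftTerm (hg : InDK p g) (hP : ∀ k, (P k).natDegree ≤ d)
    (h : ∀ x, 0 ≤ x → Tendsto (fun n => ∑ k ∈ Finset.Icc 1 n, shiftTerm g P k x) atTop (𝓝 (S x))) :
    SumsUniformlyOnBounded (Ici 0) (shiftTerm g P) S := by
  have hterm := shiftTerm_eq_eulerTerm_add p g P
  simp only [hterm] at h
  simpa only [← hterm] using
    hg.sumsUniformlyOnBounded_eulerTerm.add_polynomial (natDegree_eulerPoly_sub_le hP) h

lemma hasDerivAt_shiftTerm (hg : DifferentiableOn ℝ g (Ioi 0)) {k : ℕ} (hk : 1 ≤ k) {x : ℝ}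
    (hx : 0 ≤ x) :
    HasDerivAt (shiftTerm g P k) (shiftTerm (deriv g) (fun k => derivative (P k)) k x) x := by
  have hxk : 0 < x + k := add_pos_of_nonneg_of_pos hx (Nat.cast_pos.2 hk)
  exact ((hg.differentiableAt (Ioi_mem_nhds hxk)).hasDerivAt.comp_add_const x k).sub
    ((P k).hasDerivAt x)

lemma InDK.exists_sumsUniformlyOnBounded_shiftTerm_deriv (hg : InDK (p + 1) g)
    (hC : InC 1 g) (hP : ∀ k, (P k).natDegree ≤ d)
    (h : ∀ x, 0 ≤ x → Tendsto (fun n => ∑ k ∈ Finset.Icc 1 n, shiftTerm g P k x) atTop (𝓝 (S x))) :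
    ∃ T, SumsUniformlyOnBounded (Ici 0) (shiftTerm (deriv g) fun k => derivative (P k)) T := by
  obtain ⟨hdiff, hC'⟩ := inC_succ_iff.1 hC
  have hterm := shiftTerm_eq_eulerTerm_add p (deriv g) fun k => derivative (P k)
  obtain ⟨T, hT⟩ := (hg.deriv hdiff).sumsUniformlyOnBounded_eulerTerm
    |>.exists_add_polynomial_of_hasDerivAt
      (fun k hk => eulerTerm_eq_shiftTerm p (deriv g) ▸ continuousOn_shiftTerm hC' hk)
      (natDegree_eulerPoly_sub_le fun k => (natDegree_derivative_le _).trans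
        ((Nat.sub_le _ 1).trans (hP k)))
      (fun k hk x hx => hterm k x ▸ hasDerivAt_shiftTerm hdiff hk hx) h
  exact ⟨T, by simpa only [← hterm] using hT⟩

lemma InDK.differentiableTermwise_shiftTerm (hg : InDK p g) (hrp : r ≤ p) (hC : InC r g)
    (hP : ∀ k, (P k).natDegree ≤ d)
    (h : ∀ x, 0 ≤ x → Tendsto (fun n => ∑ k ∈ Finset.Icc 1 n, shiftTerm g P k x) atTop (𝓝 (S x))) :
    DifferentiableTermwise r (shiftTerm g P) S := by
  have hsum := hg.sumsUniformlyOnBounded_shiftTerm hP h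
  induction r generalizing p g P S with
  | zero =>
    have hcont (k : ℕ) (hk : 1 ≤ k) : ContinuousOn (shiftTerm g P k) (Ici 0) :=
      continuousOn_shiftTerm hC hk
    refine ⟨fun k hk => inC_zero_iff.2 ((hcont k hk).mono Ioi_subset_Ici_self),
      inC_zero_iff.2 ((hsum.continuousOn hcont).mono Ioi_subset_Ici_self), fun j hj => ?_⟩
    simpa [Nat.le_zero.1 hj] using hsum.mono Ioi_subset_Ici_self
  | succ r ih =>
    obtain ⟨hdiff, hC'⟩ := inC_succ_iff.1 hC
    obtain ⟨p, rfl⟩ := Nat.exists_eq_add_of_le' ((Nat.le_add_left 1 r).trans hrp)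
    obtain ⟨T, hT⟩ := hg.exists_sumsUniformlyOnBounded_shiftTerm_deriv
      (hC.mono (Nat.le_add_left 1 r)) hP h
    exact DifferentiableTermwise.of_hasDerivAt
      (fun k hk x hx => hasDerivAt_shiftTerm hdiff hk (mem_Ioi.1 hx).le)
      (hsum.mono Ioi_subset_Ici_self)
      (ih (hg.deriv hdiff) (Nat.le_of_succ_le_succ hrp) hC'
        (fun k => (natDegree_derivative_le _).trans ((Nat.sub_le _ 1).trans (hP k)))
        (fun x hx => hT.tendsto hx) hT)

end ShiftSeries

section Sigma

variable {p q : ℕ} {g : ℝ → ℝ} {x : ℝ}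

lemma InDK.of_inK (h : InDK p g) (hpq : p ≤ q) (hq : InK q g) : InDK q g :=
  ⟨h.1.mono hpq, hq⟩

/-- The coefficients of the polynomial part of the Eulerian form of `Σg` in the basis of the
binomial coefficients. -/
def sigCoeff (g : ℝ → ℝ) : ℕ → ℝ
  | 0 => 0
  | j + 1 => (Δ_[1])^[j] g 1

lemma eval_newtonPoly_sigCoeff (p : ℕ) (g : ℝ → ℝ) (x : ℝ) :
    (newtonPoly (sigCoeff g) (p + 1)).eval x =
      ∑ j ∈ Finset.Icc 1 p, Ring.choose x j * (Δ_[1])^[j - 1] g 1 := by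
  rw [eval_newtonPoly, Finset.sum_range_succ', sum_Icc_one_eq_sum_range]
  simp [sigCoeff]

lemma gaussSeq_succ_eq (p n : ℕ) (g : ℝ → ℝ) (x : ℝ) :
    gaussSeq p (n + 1) g x = -g x + (newtonPoly (sigCoeff g) (p + 1)).eval x -
      ∑ k ∈ Finset.Icc 1 n, eulerTerm p g k x := by
  rw [eval_newtonPoly_sigCoeff]
  induction n with
  | zero => simp [gaussSeq]
  | succ n ih =>
    have hstep (j : ℕ) : (Δ_[1])^[j] g ((n + 1 + 1 : ℕ) : ℝ) =
        (Δ_[1])^[j] g ((n + 1 : ℕ) : ℝ) + (Δ_[1])^[j + 1] g ((n + 1 : ℕ) : ℝ) := by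
      rw [Function.iterate_succ_apply', fwdDiff, Nat.cast_succ (n + 1)]
      ring
    rw [Finset.sum_Icc_succ_top n.succ_pos, ← sub_sub, ← ih]
    unfold gaussSeq
    rw [Finset.sum_Ico_succ_top n.succ_pos, eulerTerm, Finset.sum_range_succ']
    simp only [sum_Icc_one_eq_sum_range, Nat.add_sub_cancel, hstep, mul_add,
      Finset.sum_add_distrib, Ring.choose_zero_right, Function.iterate_zero_apply]
    ring

lemma InDK.tendsto_gaussSeq (hg : InDK p g) (hx : 0 ≤ x) :
    Tendsto (fun n => gaussSeq p n g x) atTop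
      (𝓝 (-g x + (newtonPoly (sigCoeff g) (p + 1)).eval x - eulerSum p g x)) := by
  rw [← tendsto_add_atTop_iff_nat 1]
  simp only [gaussSeq_succ_eq]
  exact (hg.sumsUniformlyOnBounded_eulerTerm.tendsto hx).const_sub _

lemma InDNat.tendsto_gaussSeq_of_le (hg : InDNat p g) (hpq : p ≤ q) {l : ℝ}
    (h : Tendsto (fun n => gaussSeq p n g x) atTop (𝓝 l)) :
    Tendsto (fun n => gaussSeq q n g x) atTop (𝓝 l) := by
  induction q, hpq using Nat.le_induction with
  | base => exact h
  | succ q hq ih =>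
    have hadd := ih.add ((hg.mono hq).const_mul (Ring.choose x (q + 1)))
    rw [mul_zero, add_zero] at hadd
    refine hadd.congr fun n => ?_
    unfold gaussSeq
    rw [Finset.sum_Icc_succ_top q.succ_pos, Nat.add_sub_cancel, ← add_assoc]

lemma InDK.tendsto_gaussSeq_sig (hg : InDK p g) (hx : 0 ≤ x) :
    Tendsto (fun n => gaussSeq p n g x) atTop (𝓝 (Sig g x)) := by
  classical
  have h : ∃ p, InDK p g := ⟨p, hg⟩
  have hmin := (Nat.find_spec h).tendsto_gaussSeq hx
  have hSig : Sig g x = limUnder atTop fun n => gaussSeq (Nat.find h) n g x := by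
    rw [Sig, dif_pos h]
  rw [hSig, hmin.limUnder_eq]
  exact (Nat.find_spec h).1.tendsto_gaussSeq_of_le (Nat.find_min' h hg) hmin

lemma InDK.sig_eq (hg : InDK p g) (hx : 0 ≤ x) :
    Sig g x = -g x + (newtonPoly (sigCoeff g) (p + 1)).eval x - eulerSum p g x :=
  tendsto_nhds_unique (hg.tendsto_gaussSeq_sig hx) (hg.tendsto_gaussSeq hx)

lemma InDK.tendsto_eulerTerm (hg : InDK p g) (hx : 0 ≤ x) :
    Tendsto (fun n => eulerTerm p g n x) atTop (𝓝 0) := by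
  have h := hg.sumsUniformlyOnBounded_eulerTerm.tendsto hx
  simp only [sum_Icc_one_eq_sum_range] at h
  rw [← tendsto_add_atTop_iff_nat 1]
  simpa [Finset.sum_range_succ] using ((tendsto_add_atTop_iff_nat 1).2 h).sub h

lemma gaussSeq_add_one (p : ℕ) {n : ℕ} (hn : 1 ≤ n) (g : ℝ → ℝ) (x : ℝ) :
    gaussSeq p n g (x + 1) = gaussSeq p n g x + g x -
      (eulerTerm p g n x + Ring.choose x p * (Δ_[1])^[p] g n) := by
  have htel := Finset.sum_Ico_sub (fun k : ℕ => g (x + k)) hn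
  have hshift (k : ℕ) : g (x + 1 + k) = g (x + (k + 1 : ℕ)) := by
    rw [Nat.cast_succ, add_right_comm, add_assoc]
  rw [Finset.sum_sub_distrib, Nat.cast_one] at htel
  unfold gaussSeq
  rw [eulerTerm, Finset.sum_range_succ]
  simp only [sum_Icc_one_eq_sum_range, Nat.add_sub_cancel, Ring.choose_succ_succ, add_mul,
    Finset.sum_add_distrib, Finset.sum_sub_distrib, hshift]
  linarith

lemma InDK.sig_add_one (hg : InDK p g) (hx : 0 ≤ x) : Sig g (x + 1) = Sig g x + g x := by
  have hright := ((hg.tendsto_gaussSeq_sig hx).add_const (g x)).sub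
    ((hg.tendsto_eulerTerm hx).add (hg.1.const_mul (Ring.choose x p)))
  rw [mul_zero, add_zero, sub_zero] at hright
  refine tendsto_nhds_unique (hg.tendsto_gaussSeq_sig (add_nonneg hx zero_le_one))
    (hright.congr' ?_)
  filter_upwards [eventually_ge_atTop 1] with n hn
  exact (gaussSeq_add_one p hn g x).symm

end Sigma

section Eulerian

variable {p r : ℕ} {g : ℝ → ℝ} {k : ℕ}

lemma continuousOn_eulerTerm (hg : InC 0 g) (hk : 1 ≤ k) :
    ContinuousOn (eulerTerm p g k) (Ici 0) := by
  rw [eulerTerm_eq_shiftTerm]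
  exact continuousOn_shiftTerm hg hk

lemma InDK.differentiableTermwise_eulerTerm (hg : InDK p g) (hC : InC r g)
    (hK : InK (max p r) g) : DifferentiableTermwise r (eulerTerm p g) (eulerSum p g) := by
  have hsum := hg.sumsUniformlyOnBounded_eulerTerm
  rw [eulerTerm_eq_shiftTerm] at hsum ⊢
  exact (hg.of_inK (le_max_left p r) hK).differentiableTermwise_shiftTerm (le_max_right p r) hC
    (natDegree_eulerPoly_le p g) fun x hx => hsum.tendsto hx

lemma InDK.sig_eqOn (hg : InDK p g) :
    EqOn (Sig g) (fun x => -g x + (newtonPoly (sigCoeff g) (p + 1)).eval x - eulerSum p g x)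
      (Ioi 0) :=
  fun _ hx => hg.sig_eq (mem_Ioi.1 hx).le

lemma InDK.inC_sig (hg : InDK p g) (hC : InC r g) (hK : InK (max p r) g) : InC r (Sig g) :=
  (((ContDiffOn.neg hC).add (contDiff_polynomial_eval _ r).contDiffOn).sub
    (hg.differentiableTermwise_eulerTerm hC hK).2.1).congr hg.sig_eqOn

end Eulerian

section WeierstrassZero

variable {r : ℕ} {g : ℝ → ℝ}

lemma InDK.succDeg_eq_zero (hg : InDK 0 g) : succDeg g = 0 :=
  Nat.sInf_eq_zero.2 (Or.inl hg.inDReal)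

lemma InDK.sig_add_one_eq_neg_eulerSum (hg : InDK 0 g) {x : ℝ} (hx : 0 ≤ x) :
    Sig g (x + 1) = -eulerSum 0 g x := by
  rw [hg.sig_add_one hx, hg.sig_eq hx, eval_newtonPoly_sigCoeff, Finset.Icc_eq_empty_of_lt one_pos,
    Finset.sum_empty]
  ring

lemma InDK.sig_one (hg : InDK 0 g) : Sig g 1 = 0 := by
  rw [← zero_add 1, hg.sig_add_one_eq_neg_eulerSum le_rfl]
  simp [eulerSum, eulerTerm]

lemma InDK.tendsto_sum_integral_eulerTerm (hg : InDK 0 g) (hC : InC 0 g) :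
    Tendsto (fun n => ∑ k ∈ Finset.Icc 1 n, ∫ t in (0 : ℝ)..1, eulerTerm 0 g k t) atTop
      (𝓝 (-asympConst g)) := by
  have hconst : -asympConst g = ∫ t in (0 : ℝ)..1, eulerSum 0 g t := by
    rw [asympConst, ← intervalIntegral.integral_neg]
    refine intervalIntegral.integral_congr fun t ht => ?_
    rw [uIcc_of_le zero_le_one] at ht
    exact neg_eq_iff_eq_neg.2 (hg.sig_add_one_eq_neg_eulerSum ht.1)
  rw [hconst]
  exact (hg.sumsUniformlyOnBounded_eulerTerm.primitive
    (fun k hk => continuousOn_eulerTerm hC hk) le_rfl).tendsto (mem_Ici.2 zero_le_one)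

lemma InDK.hasEulerConst (hg : InDK 0 g) (hC : InC 0 g) :
    HasEulerConst g ∧ eulerConst g = asympConst g := by
  have hlim : Tendsto (fun n : ℕ => -gregoryRem (succDeg g) 1 n g) atTop (𝓝 (asympConst g)) := by
    rw [hg.succDeg_eq_zero, ← tendsto_add_atTop_iff_nat 1, ← neg_neg (asympConst g)]
    refine (hg.tendsto_sum_integral_eulerTerm hC).neg.congr fun n => congrArg _ ?_
    exact (intervalIntegral.integral_finsetSum fun k hk => intervalIntegrable_of_continuousOn_Ici
      (continuousOn_eulerTerm hC (Finset.mem_Icc.1 hk).1) le_rfl zero_le_one).symm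
  have heq : eulerConst g = asympConst g := hlim.limUnder_eq
  exact ⟨by rwa [HasEulerConst, heq], heq⟩

lemma weierTermZero_eq_eulerTerm_sub (hC : InC 0 g) {k : ℕ} (hk : 1 ≤ k) (x : ℝ) :
    weierTermZero g k x = eulerTerm 0 g k x - ∫ t in (0 : ℝ)..1, eulerTerm 0 g k t := by
  have hterm (t : ℝ) : eulerTerm 0 g k t = g (t + k) - g k := by simp [eulerTerm]
  have hint : IntervalIntegrable (fun t => eulerTerm 0 g k t + g k) volume 0 1 :=
    intervalIntegrable_of_continuousOn_Ici
      ((continuousOn_eulerTerm hC hk).add continuousOn_const) le_rfl zero_le_one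
  simp only [hterm, sub_add_cancel] at hint ⊢
  rw [intervalIntegral.integral_sub hint intervalIntegrable_const, weierTermZero,
    intervalIntegral.integral_comp_add_right]
  simp [add_comm (k : ℝ) 1]

lemma weierTermZero_eq_shiftTerm (g : ℝ → ℝ) :
    weierTermZero g = shiftTerm g fun k => Polynomial.C (∫ t in (k : ℝ)..(k + 1), g t) := by
  ext k x
  simp [weierTermZero, shiftTerm]

/-- The sum of the Weierstrassian series with terms `weierTermZero g`, read off the formula that
it gives for `Σg`. -/
def weierSumZero (g : ℝ → ℝ) (x : ℝ) : ℝ := asympConst g - g x - Sig g x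

lemma InDK.tendsto_sum_weierTermZero (hg : InDK 0 g) (hC : InC 0 g) {x : ℝ} (hx : 0 ≤ x) :
    Tendsto (fun n => ∑ k ∈ Finset.Icc 1 n, weierTermZero g k x) atTop
      (𝓝 (weierSumZero g x)) := by
  have hlim : weierSumZero g x = eulerSum 0 g x - -asympConst g := by
    rw [weierSumZero, hg.sig_eq hx, eval_newtonPoly_sigCoeff]
    simp
    ring
  rw [hlim]
  refine ((hg.sumsUniformlyOnBounded_eulerTerm.tendsto hx).sub
    (hg.tendsto_sum_integral_eulerTerm hC)).congr fun n => ?_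
  rw [← Finset.sum_sub_distrib]
  exact Finset.sum_congr rfl fun k hk =>
    (weierTermZero_eq_eulerTerm_sub hC (Finset.mem_Icc.1 hk).1 x).symm

lemma InDK.sumsUniformlyOnBounded_weierTermZero (hg : InDK 0 g) (hC : InC 0 g) :
    SumsUniformlyOnBounded (Ici 0) (weierTermZero g) (weierSumZero g) := by
  have hsum := fun x (hx : (0 : ℝ) ≤ x) => hg.tendsto_sum_weierTermZero hC hx
  rw [weierTermZero_eq_shiftTerm] at hsum ⊢
  exact hg.sumsUniformlyOnBounded_shiftTerm (fun k => (Polynomial.natDegree_C _).le) hsum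

lemma continuousOn_weierTermZero (hC : InC 0 g) {k : ℕ} (hk : 1 ≤ k) :
    ContinuousOn (weierTermZero g k) (Ici 0) := by
  rw [weierTermZero_eq_shiftTerm]
  exact continuousOn_shiftTerm hC hk

lemma InDK.differentiableTermwise_weierTermZero (hg : InDK 0 g) (hC : InC r g) (hK : InK r g) :
    DifferentiableTermwise r (weierTermZero g) (weierSumZero g) := by
  have hsum := fun x (hx : (0 : ℝ) ≤ x) =>
    hg.tendsto_sum_weierTermZero (hC.mono r.zero_le) hx
  rw [weierTermZero_eq_shiftTerm] at hsum ⊢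
  exact (hg.of_inK r.zero_le hK).differentiableTermwise_shiftTerm le_rfl hC
    (fun k => (Polynomial.natDegree_C _).le) hsum

end WeierstrassZero

section WeierstrassPos

open Polynomial

variable {p r : ℕ} {g : ℝ → ℝ} {x : ℝ}

protected lemma InC.iteratedDeriv {s : ℕ} (hC : InC (s + r) g) : InC s (iteratedDeriv r g) := by
  induction r generalizing g with
  | zero => simpa using hC
  | succ r ih =>
    rw [iteratedDeriv_succ']
    exact ih (inC_succ_iff.1 hC).2

lemma InC.hasDerivAt_iteratedDeriv (hC : InC (r + 1) g) (hx : 0 < x) :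
    HasDerivAt (iteratedDeriv r g) (iteratedDeriv (r + 1) g x) x := by
  have hdiff := (inC_succ_iff.1 (InC.iteratedDeriv (s := 1) (by rwa [add_comm]))).1
  rw [iteratedDeriv_succ]
  exact (hdiff.differentiableAt (Ioi_mem_nhds hx)).hasDerivAt

lemma InC.contDiffAt (hC : InC r g) (hx : 0 < x) : ContDiffAt ℝ r g x :=
  ContDiffOn.contDiffAt hC (Ioi_mem_nhds hx)

lemma InC.contDiffAt_comp_add (hC : InC r g) {a : ℝ} (hx : 0 < x + a) :
    ContDiffAt ℝ r (fun x => g (x + a)) x :=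
  ContDiffAt.comp (g := g) x (hC.contDiffAt hx) (by fun_prop)

lemma iteratedDeriv_shiftTerm {P : ℕ → ℝ[X]} {k : ℕ} (hC : InC r g) (hx : 0 < x) :
    iteratedDeriv r (shiftTerm g P k) x =
      shiftTerm (iteratedDeriv r g) (fun k => derivative^[r] (P k)) k x := by
  have hxk : 0 < x + k := add_pos_of_pos_of_nonneg hx k.cast_nonneg
  unfold shiftTerm
  rw [iteratedDeriv_fun_sub (hC.contDiffAt_comp_add hxk)
    (contDiff_polynomial_eval _ r).contDiffAt, iteratedDeriv_comp_add_const,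
    iteratedDeriv_polynomial_eval]

lemma iteratedDeriv_eulerTerm {k : ℕ} (hC : InC p g) (hx : 0 < x) :
    iteratedDeriv p (eulerTerm p g k) x = iteratedDeriv p g (x + k) - (Δ_[1])^[p] g k := by
  rw [eulerTerm_eq_shiftTerm, iteratedDeriv_shiftTerm hC hx, shiftTerm, eulerPoly,
    iterate_derivative_newtonPoly_succ, eval_C]

lemma InDK.iteratedDeriv_sig_eq (hg : InDK p g) (hC : InC p g) (hx : 0 < x) :
    iteratedDeriv p (Sig g) x =
      -iteratedDeriv p g x + sigCoeff g p - iteratedDeriv p (eulerSum p g) x := by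
  have hS : InC p (eulerSum p g) :=
    (hg.differentiableTermwise_eulerTerm hC (by simpa using hg.2)).2.1
  have hP : ContDiffAt ℝ p (fun x => (newtonPoly (sigCoeff g) (p + 1)).eval x) x :=
    (contDiff_polynomial_eval _ p).contDiffAt
  have hgx := (hC.contDiffAt hx).neg
  rw [hg.sig_eqOn.iteratedDeriv_of_isOpen isOpen_Ioi p hx,
    iteratedDeriv_fun_sub (hgx.add hP) (hS.contDiffAt hx), iteratedDeriv_fun_add hgx hP,
    iteratedDeriv_fun_neg, iteratedDeriv_polynomial_eval, iterate_derivative_newtonPoly_succ]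
  simp only [eval_C]

lemma InDK.tendsto_sum_fwdDiff_iter_sub_iteratedDeriv (hg : InDK p g) (hC : InC p g)
    (hx : 0 < x) :
    Tendsto (fun n : ℕ => ∑ k ∈ Finset.Icc 1 n, ((Δ_[1])^[p] g (k : ℝ) - iteratedDeriv p g k))
      atTop (𝓝 (iteratedDeriv p (Sig g) x - Sig (iteratedDeriv p g) x - sigCoeff g p)) := by
  have hg' : InDK 0 (iteratedDeriv p g) := InDK.iteratedDeriv (by rwa [zero_add]) hC
  have hlim : iteratedDeriv p (Sig g) x - Sig (iteratedDeriv p g) x - sigCoeff g p =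
      eulerSum 0 (iteratedDeriv p g) x - iteratedDeriv p (eulerSum p g) x := by
    rw [hg.iteratedDeriv_sig_eq hC hx, hg'.sig_eq hx.le, eval_newtonPoly_sigCoeff]
    simp
    ring
  rw [hlim]
  refine ((hg'.sumsUniformlyOnBounded_eulerTerm.tendsto hx.le).sub
    (((hg.differentiableTermwise_eulerTerm hC (by simpa using hg.2)).2.2 p le_rfl).tendsto
      hx)).congr fun n => ?_
  rw [← Finset.sum_sub_distrib]
  refine Finset.sum_congr rfl fun k _ => ?_
  rw [iteratedDeriv_eulerTerm hC hx]
  simp [eulerTerm]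

lemma InDK.iteratedDeriv_sig (hg : InDK p g) (hC : InC p g) (hx : 0 < x) :
    iteratedDeriv p (Sig g) x = Sig (iteratedDeriv p g) x + iteratedDeriv p (Sig g) 1 := by
  have hg' : InDK 0 (iteratedDeriv p g) := InDK.iteratedDeriv (by rwa [zero_add]) hC
  have huniq := tendsto_nhds_unique (hg.tendsto_sum_fwdDiff_iter_sub_iteratedDeriv hC hx)
    (hg.tendsto_sum_fwdDiff_iter_sub_iteratedDeriv hC one_pos)
  rw [hg'.sig_one] at huniq
  linarith

lemma InDK.iteratedDeriv_sig_add_one (hg : InDK p g) (hC : InC r g) (hK : InK (max p r) g)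
    (hx : 0 < x) :
    iteratedDeriv r (Sig g) (x + 1) = iteratedDeriv r (Sig g) x + iteratedDeriv r g x := by
  have heq : EqOn (fun x => Sig g (x + 1)) (Sig g + g) (Ioi 0) :=
    fun y hy => hg.sig_add_one (mem_Ioi.1 hy).le
  have hderiv := heq.iteratedDeriv_of_isOpen isOpen_Ioi r hx
  rwa [iteratedDeriv_comp_add_const,
    iteratedDeriv_add ((hg.inC_sig hC hK).contDiffAt hx) (hC.contDiffAt hx)] at hderiv

lemma asympConst_eq_integral (g : ℝ → ℝ) : asympConst g = ∫ t in (1 : ℝ)..2, Sig g t := by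
  rw [asympConst, intervalIntegral.integral_comp_add_right]
  norm_num

lemma InDK.asympConst_iteratedDeriv (hg : InDK (p + 1) g) (hC : InC (p + 1) g) :
    asympConst (iteratedDeriv (p + 1) g) =
      iteratedDeriv p g 1 - iteratedDeriv (p + 1) (Sig g) 1 := by
  have hSig : InC (p + 1) (Sig g) := hg.inC_sig hC (by simpa using hg.2)
  have hpos {t : ℝ} (ht : t ∈ uIcc (1 : ℝ) 2) : 0 < t := by
    rw [uIcc_of_le one_le_two] at ht
    exact one_pos.trans_le ht.1
  have hint : IntervalIntegrable (iteratedDeriv (p + 1) (Sig g)) volume 1 2 :=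
    ((inC_zero_iff.1 (InC.iteratedDeriv (by rwa [zero_add]))).mono
      fun t ht => hpos ht).intervalIntegrable
  have hFTC := intervalIntegral.integral_eq_sub_of_hasDerivAt
    (fun t ht => hSig.hasDerivAt_iteratedDeriv (hpos ht)) hint
  have hstep := hg.iteratedDeriv_sig_add_one (hC.mono p.le_succ) (by simpa using hg.2) one_pos
  calc asympConst (iteratedDeriv (p + 1) g)
      = ∫ t in (1 : ℝ)..2, (iteratedDeriv (p + 1) (Sig g) t - iteratedDeriv (p + 1) (Sig g) 1) := by
        rw [asympConst_eq_integral]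
        exact intervalIntegral.integral_congr fun t ht =>
          eq_sub_of_add_eq (hg.iteratedDeriv_sig hC (hpos ht)).symm
    _ = iteratedDeriv p g 1 - iteratedDeriv (p + 1) (Sig g) 1 := by
        rw [intervalIntegral.integral_sub hint intervalIntegrable_const, hFTC,
          ← one_add_one_eq_two, hstep]
        simp

/-- The polynomial part of `weierTerm p g k`: in `eulerPoly p g k`, the leading coefficient
`Δ^p g(k)` is replaced by `g^{(p)}(k)`. -/
def weierPoly (p : ℕ) (g : ℝ → ℝ) (k : ℕ) : ℝ[X] :=
  newtonPoly (Function.update (fun j => (Δ_[1])^[j] g k) p (iteratedDeriv p g k)) (p + 1)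

lemma weierTerm_eq_shiftTerm (p : ℕ) (g : ℝ → ℝ) : weierTerm p g = shiftTerm g (weierPoly p g) := by
  ext k x
  have hlt : ∀ j ∈ Finset.range p, Ring.choose x j *
      Function.update (fun j => (Δ_[1])^[j] g (k : ℝ)) p (iteratedDeriv p g k) j =
        Ring.choose x j * (Δ_[1])^[j] g (k : ℝ) := fun j hj => by
    rw [Function.update_of_ne (Finset.mem_range.1 hj).ne]
  rw [weierTerm, shiftTerm, weierPoly, eval_newtonPoly, Finset.sum_range_succ,
    Finset.sum_congr rfl hlt, Function.update_self, sub_sub]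

lemma natDegree_weierPoly_le (p : ℕ) (g : ℝ → ℝ) (k : ℕ) : (weierPoly p g k).natDegree ≤ p :=
  natDegree_newtonPoly_succ_le _ p

lemma weierTerm_eq_eulerTerm_add (p : ℕ) (g : ℝ → ℝ) (k : ℕ) (x : ℝ) :
    weierTerm p g k x = eulerTerm p g k x +
      Ring.choose x p * ((Δ_[1])^[p] g (k : ℝ) - iteratedDeriv p g k) := by
  rw [weierTerm, eulerTerm, Finset.sum_range_succ]
  ring

/-- The sum of the Weierstrassian series with terms `weierTerm p g`, read off the formula that it
gives for `Σg`. -/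
def weierSum (p : ℕ) (g : ℝ → ℝ) (x : ℝ) : ℝ :=
  (newtonPoly (sigCoeff g) p).eval x + Ring.choose x p * iteratedDeriv p (Sig g) 1 - g x - Sig g x

lemma InDK.tendsto_sum_weierTerm (hg : InDK p g) (hC : InC p g) (hx : 0 ≤ x) :
    Tendsto (fun n => ∑ k ∈ Finset.Icc 1 n, weierTerm p g k x) atTop (𝓝 (weierSum p g x)) := by
  have hg' : InDK 0 (iteratedDeriv p g) := InDK.iteratedDeriv (by rwa [zero_add]) hC
  have hlim : weierSum p g x = eulerSum p g x +
      Ring.choose x p * (iteratedDeriv p (Sig g) 1 - Sig (iteratedDeriv p g) 1 - sigCoeff g p) := by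
    rw [weierSum, hg.sig_eq hx, hg'.sig_one, eval_newtonPoly, eval_newtonPoly,
      Finset.sum_range_succ]
    ring
  simp only [hlim, weierTerm_eq_eulerTerm_add, Finset.sum_add_distrib, ← Finset.mul_sum]
  exact (hg.sumsUniformlyOnBounded_eulerTerm.tendsto hx).add
    ((hg.tendsto_sum_fwdDiff_iter_sub_iteratedDeriv hC one_pos).const_mul _)

lemma InDK.sumsUniformlyOnBounded_weierTerm (hg : InDK p g) (hC : InC p g) :
    SumsUniformlyOnBounded (Ici 0) (weierTerm p g) (weierSum p g) := by
  have hsum := fun x (hx : (0 : ℝ) ≤ x) => hg.tendsto_sum_weierTerm hC hx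
  rw [weierTerm_eq_shiftTerm] at hsum ⊢
  exact hg.sumsUniformlyOnBounded_shiftTerm (natDegree_weierPoly_le p g) hsum

lemma continuousOn_weierTerm (hC : InC 0 g) {k : ℕ} (hk : 1 ≤ k) :
    ContinuousOn (weierTerm p g k) (Ici 0) := by
  rw [weierTerm_eq_shiftTerm]
  exact continuousOn_shiftTerm hC hk

lemma InDK.differentiableTermwise_weierTerm (hg : InDK p g) (hpr : p ≤ r) (hC : InC r g)
    (hK : InK r g) : DifferentiableTermwise r (weierTerm p g) (weierSum p g) := by
  have hsum := fun x (hx : (0 : ℝ) ≤ x) => hg.tendsto_sum_weierTerm (hC.mono hpr) hx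
  rw [weierTerm_eq_shiftTerm] at hsum ⊢
  exact (hg.of_inK hpr hK).differentiableTermwise_shiftTerm le_rfl hC
    (natDegree_weierPoly_le p g) hsum

end WeierstrassPos

end PrincipalSum

end


theorem mainTheorem7_general (g : ℝ → ℝ) :
    (∀ p : ℕ, InDK p g →
      ∃ S : ℝ → ℝ,
        SumsUniformlyOnBounded (Ici 0) (eulerTerm p g) S ∧
        (∀ x : ℝ, 0 < x →
          Sig g x = -g x +
            ∑ j ∈ Finset.Icc 1 p, Ring.choose x j * ((fwdDiff (1 : ℝ))^[j - 1] g) 1 - S x) ∧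
        (InC 0 g → InC 0 (Sig g) ∧ IntegrableTermwise (eulerTerm p g) S) ∧
        (∀ r : ℕ, InC r g → InK (max p r) g →
          InC r (Sig g) ∧ DifferentiableTermwise r (eulerTerm p g) S)) ∧
    (InC 0 g → InDK 0 g →
      (HasEulerConst g ∧ eulerConst g = asympConst g) ∧
      ∃ S : ℝ → ℝ,
        SumsUniformlyOnBounded (Ici 0) (weierTermZero g) S ∧
        (∀ x : ℝ, 0 < x → Sig g x = asympConst g - g x - S x) ∧
        (InC 0 (Sig g) ∧ IntegrableTermwise (weierTermZero g) S) ∧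
        (∀ r : ℕ, InC r g → InK r g →
          InC r (Sig g) ∧ DifferentiableTermwise r (weierTermZero g) S)) ∧
    (∀ p : ℕ, 1 ≤ p → InC p g → InDK p g →
      (HasEulerConst (iteratedDeriv p g) ∧
        eulerConst (iteratedDeriv p g) = asympConst (iteratedDeriv p g) ∧
        asympConst (iteratedDeriv p g) =
          iteratedDeriv (p - 1) g 1 - iteratedDeriv p (Sig g) 1) ∧
      ∃ S : ℝ → ℝ,
        SumsUniformlyOnBounded (Ici 0) (weierTerm p g) S ∧
        (∀ x : ℝ, 0 < x →
          Sig g x =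
            ∑ j ∈ Finset.Icc 1 (p - 1), Ring.choose x j * ((fwdDiff (1 : ℝ))^[j - 1] g) 1 +
              Ring.choose x p * iteratedDeriv p (Sig g) 1 - g x - S x) ∧
        (InC p (Sig g) ∧ IntegrableTermwise (weierTerm p g) S) ∧
        (∀ r : ℕ, InC (max p r) g → InK (max p r) g →
          InC (max p r) (Sig g) ∧ DifferentiableTermwise (max p r) (weierTerm p g) S)) := by
  refine ⟨fun p hg => ⟨eulerSum p g, hg.sumsUniformlyOnBounded_eulerTerm, fun x hx => ?_,
      fun hC => ⟨hg.inC_sig hC (by simpa using hg.2), ?_⟩,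
      fun r hC hK => ⟨hg.inC_sig hC hK, hg.differentiableTermwise_eulerTerm hC hK⟩⟩,
    fun hC hg => ?_, fun p hp hC hg => ?_⟩
  · rw [hg.sig_eq hx.le, eval_newtonPoly_sigCoeff]
  · exact hg.sumsUniformlyOnBounded_eulerTerm.integrableTermwise
      fun k hk => continuousOn_eulerTerm hC hk
  · have hsum := hg.sumsUniformlyOnBounded_weierTermZero hC
    exact ⟨hg.hasEulerConst hC, weierSumZero g, hsum, fun x _ => by rw [weierSumZero]; ring,
      ⟨hg.inC_sig hC hg.2, hsum.integrableTermwise fun k hk => continuousOn_weierTermZero hC hk⟩,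
      fun r hCr hK => ⟨hg.inC_sig hCr (by simpa using hK),
        hg.differentiableTermwise_weierTermZero hCr hK⟩⟩
  · obtain ⟨p, rfl⟩ := Nat.exists_eq_add_of_le' hp
    have hsum := hg.sumsUniformlyOnBounded_weierTerm hC
    have hderiv : InDK 0 (iteratedDeriv (p + 1) g) := InDK.iteratedDeriv (by rwa [zero_add]) hC
    obtain ⟨hγ, hγσ⟩ := hderiv.hasEulerConst (InC.iteratedDeriv (by rwa [zero_add]))
    refine ⟨⟨hγ, hγσ, hg.asympConst_iteratedDeriv hC⟩, weierSum (p + 1) g, hsum, fun x _ => ?_,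
      ⟨hg.inC_sig hC (by simpa using hg.2), hsum.integrableTermwise
        fun k hk => continuousOn_weierTerm (hC.mono (Nat.zero_le _)) hk⟩,
      fun r hCr hK => ⟨hg.inC_sig hCr (by simpa using hK),
        hg.differentiableTermwise_weierTerm (le_max_left _ r) hCr hK⟩⟩
    rw [weierSum, eval_newtonPoly_sigCoeff, Nat.add_sub_cancel]
    ring


theorem mainTheorem7 (g : ℝ → ℝ) :
    -- Eulerian form
    (∀ p : ℕ, InDK p g →
      ∃ S : ℝ → ℝ,
        SumsUniformlyOnBounded (Ici 0) (eulerTerm p g) S ∧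
        (∀ x : ℝ, 0 < x →
          Sig g x = -g x +
            ∑ j ∈ Finset.Icc 1 p, Ring.choose x j * ((fwdDiff (1 : ℝ))^[j - 1] g) 1 - S x) ∧
        (InC 0 g → InC 0 (Sig g) ∧ IntegrableTermwise (eulerTerm p g) S) ∧
        (∀ r : ℕ, InC r g → InK (max p r) g →
          InC r (Sig g) ∧ DifferentiableTermwise r (eulerTerm p g) S)) ∧
    -- Weierstrassian form, degree `-1`
    (InC 0 g → InDK 0 g →
      (HasEulerConst g ∧ eulerConst g = asympConst g) ∧
      ∃ S : ℝ → ℝ,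
        SumsUniformlyOnBounded (Ici 0) (weierTermZero g) S ∧
        (∀ x : ℝ, 0 < x → Sig g x = asympConst g - g x - S x) ∧
        (InC 0 (Sig g) ∧ IntegrableTermwise (weierTermZero g) S) ∧
        (∀ r : ℕ, InC r g → InK r g →
          InC r (Sig g) ∧ DifferentiableTermwise r (weierTermZero g) S)) ∧
    -- Weierstrassian form, degree `p - 1 ≥ 0`
    (∀ p : ℕ, 1 ≤ p → InC p g → InDK p g → asympDeg g = (((p : ℤ) - 1 : ℤ) : WithTop ℤ) →
      (HasEulerConst (iteratedDeriv p g) ∧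
        eulerConst (iteratedDeriv p g) = asympConst (iteratedDeriv p g) ∧
        asympConst (iteratedDeriv p g) =
          iteratedDeriv (p - 1) g 1 - iteratedDeriv p (Sig g) 1) ∧
      ∃ S : ℝ → ℝ,
        SumsUniformlyOnBounded (Ici 0) (weierTerm p g) S ∧
        (∀ x : ℝ, 0 < x →
          Sig g x =
            ∑ j ∈ Finset.Icc 1 (p - 1), Ring.choose x j * ((fwdDiff (1 : ℝ))^[j - 1] g) 1 +
              Ring.choose x p * iteratedDeriv p (Sig g) 1 - g x - S x) ∧
        (InC p (Sig g) ∧ IntegrableTermwise (weierTerm p g) S) ∧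
        (∀ r : ℕ, InC (max p r) g → InK (max p r) g →
          InC (max p r) (Sig g) ∧ DifferentiableTermwise (max p r) (weierTerm p g) S)) :=
  have h := mainTheorem7_general g
  ⟨h.1, h.2.1, fun p hp hC hg _ => h.2.2 p hp hC hg⟩
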